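/- Let $d,m\ge 1$, $\Gamma_n^d=[-n,n]^d\cap\mathbb Z^d$. For each $n$ let $(\varepsilon_{n,i})_{i\in\mathbb Z^d}$ be i.i.d. real random variables with mean $0$ and finite variance $\sigma^2$ (not depending on $n$). Assume that there are constants $H_0,C_0>0$ such that, for all $n,i$, $\mathbb E e^{z\varepsilon_{n,i}}$ exists for $|z|<H_0$ ($z\in\mathbb C$), and the cumulant generating function $L_n(z)=\log \mathbb E e^{z\varepsilon_{n,i}}$ (principal logarithm) is analytic with $|L_n(z)|<C_0$ in this disc. Let $(a_i)_{i\in\mathbb Z^d}$ be real with $\sum_i a_i^2<\infty$ and let $X_{n,j}=\sum_{i\in\mathbb Z^d}a_i\varepsilon_{n,j-i}$ (convergent in $L^2$). Consider $$Y_{n,j}=g(z_{n,j})+X_{n,j},\qquad j\in\Gamma_n^d,$$ where $g:\mathbb R^m\to\mathbb R$ is bounded and continuous and the design points $z_{n,j}$ lie in a fixed compact subset of $\mathbb R^m$. For a kernel $K:\mathbb R^m\to[0,\infty)$ and bandwidths $h_n>0$, $h_n\to0$, let $$g_n(z)=\sum_{j\in\Gamma_n^d}w_{n,j}(z)Y_{n,j},\qquad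 w_{n,j}(z)=\frac{K((z-z_{n,j})/h_n)}{\sum_{i\in\Gamma_n^d}K((z-z_{n,i})/h_n)}$$ (with $w_{n,j}(z)=0$ if the denominator vanishes, which under the assumptions below happens for at most finitely many $n$). Fix $z\in\mathbb R^m$ and put $b_{n,j}(z)=\sum_{i\in\Gamma_n^d}w_{n,i}(z)a_{i-j}$, $B_n(z)=\sigma^2\sum_{j\in\mathbb Z^d}b_{n,j}(z)^2$, $M_n(z)=\max_{j\in\mathbb Z^d}|b_{n,j}(z)|$. Let $H_n>0$ satisfy $H_n\propto M_n(z)^{-1}$, i.e. $H_n/M_n(z)^{-1}$ converges to a positive constant, and suppose $B_n(z)H_n^2\to\infty$. Then there are power series $\lambda_n(t)=\sum_{k\ge0}\beta_{kn}t^k$, whose coefficients $(\beta_{kn})_k$ are a function of $H_n$ and of the cumulants of the variables $b_{n,j}(z)\varepsilon_{n,j}$, $j\in\mathbb Z^d$, only (for each $d$, one and the same function for all models and all $n$), and which for some $\rho>0$ converge and are bounded uniformly in $n$ on $|t|<\rho$, such that for every sequence $x=x_n\ge0$ with $x=o(H_n\sqrt{B_n(z)})$, as $n\to\infty$, $$P\big(g_n(z)-\mathbb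 E g_n(z)>x\sqrt{B_n(z)}\big)=(1-\Phi(x))\exp\Big\{\frac{x^3}{H_n\sqrt{B_n(z)}}\lambda_n\Big(\frac{x}{H_n\sqrt{B_n(z)}}\Big)\Big\}\Big(1+O\Big(\frac{x+1}{H_n\sqrt{B_n(z)}}\Big)\Big),$$ where $\Phi$ is the standard normal distribution function, and the constant in $O(\cdot)$ does not depend on the sequence $x$. -/

import Mathlib

open MeasureTheory ProbabilityTheory Filter Topology Asymptotics

noncomputable section

namespace KernelRegression

/-- The box `[-n, n]^d ∩ ℤ^d`. -/
def box (d n : ℕ) : Finset (Fin d → ℤ) :=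
  Finset.Icc (fun _ => -(n : ℤ)) (fun _ => (n : ℤ))

/-- `a n ∝ b n`: the ratio converges to a positive constant. -/
def IsPropTo (a b : ℕ → ℝ) : Prop :=
  ∃ c : ℝ, 0 < c ∧ Tendsto (fun n => a n / b n) atTop (𝓝 c)

/-- The cumulant generating function `L(z) = log E exp(z X)` of a complex argument,
with the principal value of the logarithm. -/
def complexCGF {Ω : Type*} [MeasurableSpace Ω] (X : Ω → ℝ) (μ : Measure Ω) (z : ℂ) : ℂ :=
  Complex.log (complexMGF X μ z)

/-- `L` exists and is analytic in the disc `|z| < H`, where `|L(z)| < C`. -/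
structure CramerCondition {Ω : Type*} [MeasurableSpace Ω] (X : Ω → ℝ) (μ : Measure Ω)
    (H C : ℝ) : Prop where
  integrable : ∀ z ∈ Metric.ball (0 : ℂ) H,
    Integrable (fun ω => Complex.exp (z * (X ω : ℂ))) μ
  analytic : AnalyticOnNhd ℂ (complexCGF X μ) (Metric.ball (0 : ℂ) H)
  bound : ∀ z ∈ Metric.ball (0 : ℂ) H, ‖complexCGF X μ z‖ < C

/-- The cumulant of order `k`: the `k`-th derivative at `0` of `t ↦ log E exp(t X)`. -/
def cumulant {Ω : Type*} [MeasurableSpace Ω] (X : Ω → ℝ) (μ : Measure Ω) (k : ℕ) : ℝ :=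
  iteratedDeriv k (cgf X μ) 0

/-- The linear random field `X_j = ∑_{i ∈ ℤ^d} a_i ε_{j-i}`, the series being summed in `L²`. -/
def linearField {d : ℕ} {Ω : Type*} [MeasurableSpace Ω] (μ : Measure Ω)
    (a : (Fin d → ℤ) → ℝ) (ε : (Fin d → ℤ) → Ω → ℝ) (hε : ∀ i, MemLp (ε i) 2 μ)
    (j : Fin d → ℤ) : Ω → ℝ :=
  ((∑' i : Fin d → ℤ, a i • (hε (j - i)).toLp (ε (j - i)) : Lp ℝ 2 μ) : Ω → ℝ)

/-- The kernel weights `w_{n,j}(z) = K((z - z_{n,j})/h_n) / ∑_{i ∈ [-n,n]^d} K((z - z_{n,i})/h_n)`,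
for design points `pt n j = z_{n,j}` and bandwidths `h`. -/
def weight {d m : ℕ} (K : EuclideanSpace ℝ (Fin m) → ℝ) (h : ℕ → ℝ)
    (pt : ℕ → (Fin d → ℤ) → EuclideanSpace ℝ (Fin m)) (n : ℕ) (j : Fin d → ℤ)
    (z : EuclideanSpace ℝ (Fin m)) : ℝ :=
  K ((h n)⁻¹ • (z - pt n j)) / ∑ i ∈ box d n, K ((h n)⁻¹ • (z - pt n i))

/-- The kernel estimator `g_n(z) = ∑_{j ∈ [-n,n]^d} w_{n,j}(z) Y_{n,j}`. -/
def estimator {d m : ℕ} {Ω : Type*} (K : EuclideanSpace ℝ (Fin m) → ℝ) (h : ℕ → ℝ)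
    (pt : ℕ → (Fin d → ℤ) → EuclideanSpace ℝ (Fin m)) (Y : ℕ → (Fin d → ℤ) → Ω → ℝ)
    (n : ℕ) (z : EuclideanSpace ℝ (Fin m)) (ω : Ω) : ℝ :=
  ∑ j ∈ box d n, weight K h pt n j z * Y n j ω

/-- `b_{n,j}(z) = ∑_{i ∈ [-n,n]^d} w_{n,i}(z) a_{i-j}`. -/
def coeff {d m : ℕ} (K : EuclideanSpace ℝ (Fin m) → ℝ) (h : ℕ → ℝ)
    (pt : ℕ → (Fin d → ℤ) → EuclideanSpace ℝ (Fin m)) (a : (Fin d → ℤ) → ℝ)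
    (n : ℕ) (j : Fin d → ℤ) (z : EuclideanSpace ℝ (Fin m)) : ℝ :=
  ∑ i ∈ box d n, weight K h pt n i z * a (i - j)

/-- `B_n(z) = σ² ∑_{j ∈ ℤ^d} b_{n,j}(z)²`. -/
def varB {d m : ℕ} (K : EuclideanSpace ℝ (Fin m) → ℝ) (h : ℕ → ℝ)
    (pt : ℕ → (Fin d → ℤ) → EuclideanSpace ℝ (Fin m)) (a : (Fin d → ℤ) → ℝ) (σ : ℝ)
    (n : ℕ) (z : EuclideanSpace ℝ (Fin m)) : ℝ :=
  σ ^ 2 * ∑' j : Fin d → ℤ, coeff K h pt a n j z ^ 2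

/-- `M_n(z) = max_{j ∈ ℤ^d} |b_{n,j}(z)|`. -/
def maxM {d m : ℕ} (K : EuclideanSpace ℝ (Fin m) → ℝ) (h : ℕ → ℝ)
    (pt : ℕ → (Fin d → ℤ) → EuclideanSpace ℝ (Fin m)) (a : (Fin d → ℤ) → ℝ)
    (n : ℕ) (z : EuclideanSpace ℝ (Fin m)) : ℝ :=
  ⨆ j : Fin d → ℤ, |coeff K h pt a n j z|

/-- The standard normal distribution function. -/
def stdNormalCDF (x : ℝ) : ℝ := cdf (gaussianReal 0 1) x

end KernelRegression

end

/-!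
Multiplied by `H`, the centred estimator is the `L²` sum of the independent variables
`H b_j ε_j`, whose weights `H b_j` are bounded because `H` is of the order of `1 / max |b_j|`.
The bound on the cumulant generating functions of the noise therefore gives the sum a cumulant
generating function `V φ` on a fixed disc, where `V = H² B` is its variance and
`φ u = u² / 2 + O(u³)` uniformly in the model: a normalised cumulant of order `k ≥ 3` is a weighted
mean of terms of geometric growth in `k`.

For a law with cumulant generating function `V φ` and `V` large, Cramér's argument applies. Let
`t(y)` solve `φ' (t(y)) = y`. Tilting by `exp (t(y) x)` moves the mean to `y V`, and the tail beyond
`y V` becomes `exp (V (φ (t(y)) - y t(y)))` times a Laplace transform of the tilted law. That law is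
compared with a Gaussian through a smoothing inequality. Since `y t(y) - φ (t(y))` is the Legendre
transform of `φ`, it equals `y² / 2 - y³ λ(y)` with `λ` analytic on a fixed disc; the term `y² / 2`
is absorbed by the Gaussian tail, and the coefficients of `λ` are the `β_k`.
-/

noncomputable section

namespace KernelRegression

/-! ### The Fejér kernel -/

/-- The Fejér kernel `x ↦ 2 (1 - cos x) / x²`, not normalized to have integral one; it is the
smoothing kernel in Esseen's inequality because its Fourier transform has compact support. -/
def fejer (x : ℝ) : ℝ := Real.sinc (x / 2) ^ 2

lemma continuous_fejer : Continuous fejer := by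
  unfold fejer
  fun_prop

lemma fejer_nonneg (x : ℝ) : 0 ≤ fejer x := sq_nonneg _

lemma fejer_le_one (x : ℝ) : fejer x ≤ 1 :=
  (sq_le_one_iff_abs_le_one _).2 (Real.abs_sinc_le_one _)

lemma norm_fejer_le_one (x : ℝ) : ‖fejer x‖ ≤ 1 := by
  rw [Real.norm_of_nonneg (fejer_nonneg x)]
  exact fejer_le_one x

lemma fejer_neg (x : ℝ) : fejer (-x) = fejer x := by
  rw [fejer, fejer, neg_div, Real.sinc_neg]

lemma sq_mul_fejer (x : ℝ) : x ^ 2 * fejer x = 2 * (1 - Real.cos x) := by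
  rcases eq_or_ne x 0 with rfl | hx
  · simp
  · have half_angle : Real.cos x = 1 - 2 * Real.sin (x / 2) ^ 2 := by
      rw [← mul_div_cancel₀ x two_ne_zero, Real.cos_two_mul, Real.cos_sq']
      ring_nf
    rw [fejer, Real.sinc_of_ne_zero (by positivity), half_angle]
    field_simp
    ring

lemma sq_mul_fejer_le (x : ℝ) : x ^ 2 * fejer x ≤ 4 := by
  rw [sq_mul_fejer]
  linarith [Real.neg_one_le_cos x]

lemma integrable_fejer : Integrable fejer := by
  refine (integrable_inv_one_add_sq.const_mul 5).mono'
    continuous_fejer.aestronglyMeasurable (ae_of_all _ fun x => ?_)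
  rw [Real.norm_of_nonneg (fejer_nonneg x), ← div_eq_mul_inv, le_div_iff₀ (by positivity)]
  linarith [sq_mul_fejer_le x, fejer_le_one x]

lemma integral_fejer_pos : 0 < ∫ x, fejer x :=
  integral_pos_of_integrable_nonneg_nonzero (x := 0) continuous_fejer integrable_fejer
    fejer_nonneg (by simp [fejer])

lemma setIntegral_Ioi_fejer_le {h : ℝ} (hh : 0 < h) : ∫ x in Set.Ioi h, fejer x ≤ 4 / h := by
  have integral_bound : ∫ x in Set.Ioi h, 4 * x ^ (-2 : ℝ) = 4 / h := by
    rw [integral_const_mul, integral_Ioi_rpow_of_lt (by norm_num) hh]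
    norm_num [Real.rpow_neg_one]
    ring
  rw [← integral_bound]
  refine setIntegral_mono_on integrable_fejer.integrableOn
    ((integrableOn_Ioi_rpow_of_lt (by norm_num) hh).const_mul 4) measurableSet_Ioi fun x hx => ?_
  have hx0 : 0 < x := hh.trans hx
  rw [Real.rpow_neg hx0.le, ← div_eq_mul_inv, le_div_iff₀ (by positivity), Real.rpow_two, mul_comm]
  exact sq_mul_fejer_le x

lemma setIntegral_compl_Icc_fejer_le {h : ℝ} (hh : 0 < h) :
    ∫ x in (Set.Icc (-h) h)ᶜ, fejer x ≤ 8 / h := by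
  have compl_eq : (Set.Icc (-h) h)ᶜ = Set.Iio (-h) ∪ Set.Ioi h := by
    ext x
    simp only [Set.mem_compl_iff, Set.mem_Icc, not_and_or, not_le, Set.mem_union, Set.mem_Iio,
      Set.mem_Ioi]
  have left_tail : ∫ x in Set.Iio (-h), fejer x = ∫ x in Set.Ioi h, fejer x := by
    rw [← integral_Iic_eq_integral_Iio, ← integral_comp_neg_Ioi]
    simp only [fejer_neg]
  have hdisj : Disjoint (Set.Iio (-h)) (Set.Ioi h) :=
    Set.Iio_disjoint_Ioi_of_le (by linarith)
  rw [compl_eq, setIntegral_union hdisj measurableSet_Ioi integrable_fejer.integrableOn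
    integrable_fejer.integrableOn, left_tail]
  calc _ ≤ 4 / h + 4 / h := add_le_add (setIntegral_Ioi_fejer_le hh) (setIntegral_Ioi_fejer_le hh)
    _ = 8 / h := by ring

lemma integral_one_sub_mul_cos (x : ℝ) :
    ∫ t in (0 : ℝ)..1, (1 - t) * Real.cos (t * x) = fejer x / 2 := by
  rcases eq_or_ne x 0 with rfl | hx
  · simp only [mul_zero, Real.cos_zero, mul_one, fejer, zero_div, Real.sinc_zero, one_pow]
    rw [intervalIntegral.integral_sub (by simp) (by simp)]
    norm_num [integral_id]
  · have hderiv : ∀ t ∈ Set.uIcc (0 : ℝ) 1, HasDerivAt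
        (fun t : ℝ => (1 - t) * (Real.sin (t * x) / x) - Real.cos (t * x) / x ^ 2)
        ((1 - t) * Real.cos (t * x)) t := by
      intro t _
      have hlin : HasDerivAt (fun t : ℝ => t * x) x t := by
        simpa using (hasDerivAt_id t).mul_const x
      convert! (((hasDerivAt_id t).const_sub 1).mul (hlin.sin.div_const x)).sub
        (hlin.cos.div_const (x ^ 2)) using 1
      simp only [id]
      field_simp
      ring
    rw [intervalIntegral.integral_eq_sub_of_hasDerivAt hderiv
      (Continuous.intervalIntegrable (by fun_prop) _ _),
      show fejer x = 2 * (1 - Real.cos x) / x ^ 2 by rw [← sq_mul_fejer]; field_simp]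
    simp only [sub_self, zero_mul, one_mul, zero_sub, sub_zero, Real.sin_zero, Real.cos_zero,
      zero_div, mul_zero]
    field_simp
    ring

lemma integral_one_sub_abs_mul_cos (x : ℝ) :
    ∫ t in (-1 : ℝ)..1, (1 - |t|) * Real.cos (t * x) = fejer x := by
  have hint (a b : ℝ) :
      IntervalIntegrable (fun t : ℝ => (1 - |t|) * Real.cos (t * x)) volume a b :=
    Continuous.intervalIntegrable (by fun_prop) a b
  have right_half : ∫ t in (0 : ℝ)..1, (1 - |t|) * Real.cos (t * x) = fejer x / 2 := by
    rw [← integral_one_sub_mul_cos]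
    refine intervalIntegral.integral_congr fun t ht => ?_
    rw [Set.uIcc_of_le zero_le_one] at ht
    simp only [abs_of_nonneg ht.1]
  have left_half : ∫ t in (-1 : ℝ)..0, (1 - |t|) * Real.cos (t * x) = fejer x / 2 := by
    rw [← right_half]
    simpa using (intervalIntegral.integral_comp_neg (a := (0 : ℝ)) (b := 1)
      (fun t => (1 - |t|) * Real.cos (t * x))).symm
  rw [← intervalIntegral.integral_add_adjacent_intervals (hint (-1) 0) (hint 0 1), left_half,
    right_half, add_halves]

/-! ### Esseen's smoothing inequality -/

section Smoothing

/-- The distribution function of `ν` convolved with the Fejér kernel, the smooth substitute for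
`cdf ν` in Esseen's inequality. -/
def smoothedCDF (ν : Measure ℝ) (x : ℝ) : ℝ := ∫ s, cdf ν (x - s) * fejer s

variable (ν : Measure ℝ)

lemma integrable_cdf_sub_mul_fejer (x : ℝ) : Integrable (fun s => cdf ν (x - s) * fejer s) := by
  refine integrable_fejer.bdd_mul (c := 1) ?_ (ae_of_all _ fun s => ?_)
  · exact ((monotone_cdf ν).measurable.comp
      (measurable_const.sub measurable_id)).aestronglyMeasurable
  · rw [Real.norm_of_nonneg (cdf_nonneg _ _)]
    exact cdf_le_one _ _

lemma tendsto_smoothedCDF_atBot : Tendsto (smoothedCDF ν) atBot (𝓝 0) := by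
  rw [← integral_zero ℝ ℝ (μ := volume)]
  refine tendsto_integral_filter_of_dominated_convergence fejer
    (Eventually.of_forall fun x => (integrable_cdf_sub_mul_fejer ν x).aestronglyMeasurable)
    (Eventually.of_forall fun x => ae_of_all _ fun s => ?_) integrable_fejer
    (ae_of_all _ fun s => ?_)
  · rw [norm_mul, Real.norm_of_nonneg (cdf_nonneg _ _), Real.norm_of_nonneg (fejer_nonneg _)]
    exact mul_le_of_le_one_left (fejer_nonneg _) (cdf_le_one _ _)
  · simpa [sub_eq_add_neg] using ((tendsto_cdf_atBot ν).comp
      (tendsto_atBot_add_const_right _ (-s) tendsto_id)).mul_const (fejer s)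

lemma norm_integral_exp_neg_mul_I_le {t : ℝ} (ht : t ≠ 0) (a b : ℝ) :
    ‖∫ r in a..b, Complex.exp (-(t * r * Complex.I))‖ ≤ 2 / |t| := by
  have hexp (r : ℝ) :
      Complex.exp (-(t * r * Complex.I)) = Complex.exp (-(t * Complex.I) * r) := by
    congr 1
    ring
  have hnorm (r : ℝ) : ‖Complex.exp (-(t * Complex.I) * r)‖ = 1 := by
    rw [← Complex.norm_exp_ofReal_mul_I (-(t * r))]
    push_cast
    ring_nf
  simp_rw [hexp]
  rw [integral_exp_mul_complex (by simp [ht]), norm_div, norm_neg, norm_mul, Complex.norm_I,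
    mul_one, Complex.norm_real, Real.norm_eq_abs]
  gcongr
  refine (norm_sub_le _ _).trans ?_
  rw [hnorm, hnorm, one_add_one_eq_two]

variable [IsProbabilityMeasure ν]

lemma smoothedCDF_eq_integral (x : ℝ) :
    smoothedCDF ν x = ∫ z, (∫ s in Set.Iic (x - z), fejer s) ∂ν := by
  have inner_eq (s : ℝ) : cdf ν (x - s) * fejer s
      = ∫ z, (Set.Iic (x - s)).indicator (fun _ => fejer s) z ∂ν := by
    rw [integral_indicator measurableSet_Iic, setIntegral_const, cdf_eq_real, smul_eq_mul]
  have outer_eq (z : ℝ) : ∫ s in Set.Iic (x - z), fejer s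
      = ∫ s, (Set.Iic (x - s)).indicator (fun _ => fejer s) z := by
    rw [← integral_indicator measurableSet_Iic]
    simp only [Set.indicator, Set.mem_Iic, le_sub_comm]
  have uncurry_eq : (Function.uncurry fun s z => (Set.Iic (x - s)).indicator (fun _ => fejer s) z)
      = {p : ℝ × ℝ | p.2 ≤ x - p.1}.indicator (fun p => fejer p.1) := by
    ext p
    simp only [Function.uncurry, Set.indicator, Set.mem_Iic, Set.mem_ofPred_eq]
  rw [smoothedCDF]
  simp_rw [inner_eq, outer_eq]
  rw [integral_integral_swap]
  rw [uncurry_eq]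
  exact (integrable_fejer.comp_fst ν).indicator
    (measurableSet_le measurable_snd (measurable_const.sub measurable_fst))

lemma integrable_setIntegral_Iic_sub_fejer (x : ℝ) :
    Integrable (fun z => ∫ s in Set.Iic (x - z), fejer s) ν := by
  have hmono : Monotone (fun c => ∫ s in Set.Iic c, fejer s) := fun c c' hc =>
    setIntegral_mono_set integrable_fejer.integrableOn (ae_of_all _ fejer_nonneg)
      (Set.Iic_subset_Iic.2 hc).eventuallyLE
  refine Integrable.of_bound (C := ∫ s, fejer s)
    (hmono.measurable.comp (measurable_const.sub measurable_id)).aestronglyMeasurable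
    (ae_of_all _ fun z => ?_)
  rw [Real.norm_of_nonneg (integral_nonneg fejer_nonneg)]
  exact setIntegral_le_integral integrable_fejer (ae_of_all _ fejer_nonneg)

lemma smoothedCDF_sub_eq_intervalIntegral {a b : ℝ} (hab : a ≤ b) :
    smoothedCDF ν b - smoothedCDF ν a = ∫ r in a..b, ∫ z, fejer (r - z) ∂ν := by
  have increment (z : ℝ) : (∫ s in Set.Iic (b - z), fejer s) - ∫ s in Set.Iic (a - z), fejer s
      = ∫ r in a..b, fejer (r - z) := by
    rw [intervalIntegral.integral_Iic_sub_Iic integrable_fejer.integrableOn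
      integrable_fejer.integrableOn, intervalIntegral.integral_comp_sub_right fejer z]
  rw [smoothedCDF_eq_integral, smoothedCDF_eq_integral,
    ← integral_sub (integrable_setIntegral_Iic_sub_fejer ν b)
      (integrable_setIntegral_Iic_sub_fejer ν a)]
  simp_rw [increment, intervalIntegral.integral_of_le hab]
  exact integral_integral_swap (Integrable.of_bound (C := 1)
    (continuous_fejer.comp (continuous_snd.sub continuous_fst)).aestronglyMeasurable
    (ae_of_all _ fun p => norm_fejer_le_one _))

lemma integral_cos_mul_sub_eq_re_charFun (t r : ℝ) :
    ∫ z, Real.cos (t * (r - z)) ∂ν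
      = (charFun ν t * Complex.exp (-(t * r * Complex.I))).re := by
  have hint : Integrable
      (fun z : ℝ => Complex.exp (t * z * Complex.I) * Complex.exp (-(t * r * Complex.I))) ν := by
    refine Integrable.of_bound (C := 1) (by fun_prop) (ae_of_all _ fun z => ?_)
    rw [← Complex.exp_add, show (t * z * Complex.I + -(t * r * Complex.I) : ℂ)
      = ((t * (z - r) : ℝ) : ℂ) * Complex.I by push_cast; ring, Complex.norm_exp_ofReal_mul_I]
  rw [charFun_apply_real, ← integral_mul_const]
  refine Eq.trans (integral_congr_ae (ae_of_all _ fun z => ?_)) (integral_re (𝕜 := ℂ) hint)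
  simp only [RCLike.re_to_complex]
  rw [← Complex.exp_add, show (t * z * Complex.I + -(t * r * Complex.I) : ℂ)
    = ((-(t * (r - z)) : ℝ) : ℂ) * Complex.I by push_cast; ring, Complex.exp_ofReal_mul_I_re,
    Real.cos_neg]

lemma integral_fejer_sub_eq_charFun (r : ℝ) :
    ∫ z, fejer (r - z) ∂ν
      = ∫ t in (-1 : ℝ)..1, (1 - |t|) * (charFun ν t * Complex.exp (-(t * r * Complex.I))).re := by
  simp_rw [← integral_one_sub_abs_mul_cos, ← integral_cos_mul_sub_eq_re_charFun,
    ← integral_const_mul]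
  refine (intervalIntegral_integral_swap ?_).symm
  rw [Set.uIoc_of_le (by norm_num)]
  have hcont : Continuous (Function.uncurry fun t z : ℝ => (1 - |t|) * Real.cos (t * (r - z))) := by
    fun_prop
  refine Integrable.of_bound (C := 1) hcont.aestronglyMeasurable ?_
  refine (Measure.ae_prod_iff_ae_ae (measurableSet_le hcont.norm.measurable
    measurable_const)).2 ?_
  filter_upwards [ae_restrict_mem measurableSet_Ioc] with t ht
  refine ae_of_all _ fun z => ?_
  have ht1 : |t| ≤ 1 := abs_le.2 ⟨ht.1.le, ht.2⟩
  rw [Function.uncurry_apply_pair, norm_mul, Real.norm_of_nonneg (sub_nonneg.2 ht1)]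
  exact mul_le_one₀ (sub_le_self _ (abs_nonneg t)) (abs_nonneg _) (Real.abs_cos_le_one _)

lemma smoothedCDF_sub_eq_integral_charFun {a b : ℝ} (hab : a ≤ b) :
    smoothedCDF ν b - smoothedCDF ν a = ∫ t in (-1 : ℝ)..1,
      (1 - |t|) * (charFun ν t * ∫ r in a..b, Complex.exp (-(t * r * Complex.I))).re := by
  have hint (t : ℝ) : IntervalIntegrable
      (fun r : ℝ => charFun ν t * Complex.exp (-(t * r * Complex.I))) volume a b :=
    Continuous.intervalIntegrable (by fun_prop) _ _
  have : Continuous (charFun ν) := continuous_charFun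
  simp_rw [smoothedCDF_sub_eq_intervalIntegral ν hab, integral_fejer_sub_eq_charFun]
  rw [intervalIntegral_intervalIntegral_swap]
  · refine intervalIntegral.integral_congr fun t _ => ?_
    refine (intervalIntegral.integral_const_mul _ _).trans (congrArg ((1 - |t|) * ·) ?_)
    rw [← intervalIntegral.integral_const_mul]
    exact Complex.reCLM.intervalIntegral_comp_comm (hint t)
  · have hjoint : Continuous (Function.uncurry fun r t : ℝ =>
        (1 - |t|) * (charFun ν t * Complex.exp (-(t * r * Complex.I))).re) := by
      fun_prop
    exact (hjoint.continuousOn.integrableOn_compact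
      (isCompact_uIcc.prod isCompact_uIcc)).mono_set
      (Set.prod_mono Set.uIoc_subset_uIcc Set.uIoc_subset_uIcc)

variable (γ : Measure ℝ) [IsProbabilityMeasure γ]

lemma abs_smoothedCDF_sub_sub_le {G : ℝ → ℝ} (hG : IntervalIntegrable G volume (-1) 1)
    (hνγ : ∀ t ∈ Set.Icc (-1 : ℝ) 1, ‖charFun ν t - charFun γ t‖ ≤ |t| * G t)
    {a b : ℝ} (hab : a ≤ b) :
    |(smoothedCDF ν b - smoothedCDF γ b) - (smoothedCDF ν a - smoothedCDF γ a)|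
      ≤ 2 * ∫ t in (-1 : ℝ)..1, G t := by
  have hcont (ρ : Measure ℝ) [IsProbabilityMeasure ρ] : IntervalIntegrable (fun t : ℝ => (1 - |t|) *
      (charFun ρ t * ∫ r in a..b, Complex.exp (-(t * r * Complex.I))).re) volume (-1) 1 := by
    have := intervalIntegral.continuous_parametric_intervalIntegral_of_continuous' (μ := volume)
      (f := fun t r : ℝ => Complex.exp (-(t * r * Complex.I))) (by fun_prop) a b
    have := continuous_charFun (μ := ρ)
    exact Continuous.intervalIntegrable (by fun_prop) _ _
  rw [sub_sub_sub_comm, smoothedCDF_sub_eq_integral_charFun ν hab,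
    smoothedCDF_sub_eq_integral_charFun γ hab, ← intervalIntegral.integral_sub (hcont ν) (hcont γ),
    ← intervalIntegral.integral_const_mul, ← Real.norm_eq_abs]
  refine intervalIntegral.norm_integral_le_of_norm_le (by norm_num) ?_ (hG.const_mul 2)
  filter_upwards [compl_mem_ae_iff.2 (measure_singleton (0 : ℝ))] with t (ht0 : t ≠ 0) ht
  have ht1 : |t| ≤ 1 := abs_le.2 ⟨ht.1.le, ht.2⟩
  rw [← mul_sub, ← Complex.sub_re, ← sub_mul, norm_mul, Real.norm_of_nonneg (sub_nonneg.2 ht1)]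
  calc (1 - |t|) * ‖((charFun ν t - charFun γ t) *
        ∫ r in a..b, Complex.exp (-(t * r * Complex.I))).re‖
      ≤ 1 * ‖(charFun ν t - charFun γ t) * ∫ r in a..b, Complex.exp (-(t * r * Complex.I))‖ := by
        gcongr
        · exact sub_le_self _ (abs_nonneg t)
        · exact Complex.abs_re_le_norm _
    _ ≤ 1 * (|t| * G t * (2 / |t|)) := by
        have hδ := hνγ t (Set.Ioc_subset_Icc_self ht)
        rw [norm_mul]
        gcongr
        · exact (norm_nonneg _).trans hδ
        · exact norm_integral_exp_neg_mul_I_le ht0 a b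
    _ = 2 * G t := by
        have := abs_pos.2 ht0
        field_simp

lemma abs_smoothedCDF_sub_le {G : ℝ → ℝ} (hG : IntervalIntegrable G volume (-1) 1)
    (hνγ : ∀ t ∈ Set.Icc (-1 : ℝ) 1, ‖charFun ν t - charFun γ t‖ ≤ |t| * G t) (x : ℝ) :
    |smoothedCDF ν x - smoothedCDF γ x| ≤ 2 * ∫ t in (-1 : ℝ)..1, G t := by
  have hlim := (((tendsto_smoothedCDF_atBot ν).sub (tendsto_smoothedCDF_atBot γ)).const_sub
    (smoothedCDF ν x - smoothedCDF γ x)).abs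
  rw [sub_zero, sub_zero] at hlim
  refine le_of_tendsto hlim ?_
  filter_upwards [eventually_le_atBot x] with a ha
  exact abs_smoothedCDF_sub_sub_le ν γ hG hνγ ha

end Smoothing

lemma mul_sub_le_integral_mul_fejer {f : ℝ → ℝ} {c η h : ℝ} (hf : Measurable f)
    (hfη : ∀ s, |f s| ≤ η) (hcη : |c| ≤ η) (hh : 0 < h) (hfc : ∀ s ∈ Set.Icc (-h) h, c ≤ f s) :
    c * (∫ s, fejer s) - (2 * η) * (8 / h) ≤ ∫ s, f s * fejer s := by
  have hint : Integrable (fun s => f s * fejer s) :=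
    integrable_fejer.bdd_mul hf.aestronglyMeasurable (ae_of_all _ hfη)
  have tail := setIntegral_compl_Icc_fejer_le hh
  have tail_nonneg : 0 ≤ ∫ s in (Set.Icc (-h) h)ᶜ, fejer s := integral_nonneg fejer_nonneg
  have centre_lower :
      c * ∫ s in Set.Icc (-h) h, fejer s ≤ ∫ s in Set.Icc (-h) h, f s * fejer s := by
    rw [← integral_const_mul]
    exact setIntegral_mono_on (integrable_fejer.integrableOn.const_mul _) hint.integrableOn
      measurableSet_Icc fun s hs => mul_le_mul_of_nonneg_right (hfc s hs) (fejer_nonneg s)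
  have tail_lower : -η * ∫ s in (Set.Icc (-h) h)ᶜ, fejer s
      ≤ ∫ s in (Set.Icc (-h) h)ᶜ, f s * fejer s := by
    rw [← integral_const_mul]
    exact integral_mono (integrable_fejer.integrableOn.const_mul _) hint.integrableOn
      fun s => mul_le_mul_of_nonneg_right (abs_le.1 (hfη s)).1 (fejer_nonneg s)
  rw [← integral_add_compl (measurableSet_Icc (a := -h) (b := h)) integrable_fejer,
    ← integral_add_compl (measurableSet_Icc (a := -h) (b := h)) hint]
  have hη : 0 ≤ η := (abs_nonneg c).trans hcη
  have tail_const := mul_le_mul_of_nonneg_right (abs_le.1 hcη).2 tail_nonneg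
  have tail_scaled := mul_le_mul_of_nonneg_left tail (mul_nonneg zero_le_two hη)
  linarith

lemma le_of_integral_sub_mul_fejer_le {Δ : ℝ → ℝ} {η m κ x₀ : ℝ} (hm : 0 < m)
    (hΔ : Measurable Δ) (hΔη : ∀ x, |Δ x| ≤ η)
    (hdec : ∀ x y, x ≤ y → Δ x - m * (y - x) ≤ Δ y) (hx₀ : 0 < Δ x₀) (hη : η ≤ 2 * Δ x₀)
    (hκ : ∀ x, ∫ s, Δ (x - s) * fejer s ≤ κ) :
    Δ x₀ ≤ 2 / (∫ s, fejer s) * (κ + 128 * m) := by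
  -- `Δ ≥ Δ x₀ / 2` on `[x₀, x₀ + 2 h]`, so it pays to smooth at the midpoint `x₀ + h`.
  set h := Δ x₀ / (4 * m) with h_def
  have hh : 0 < h := by positivity
  have hmh : m * h = Δ x₀ / 4 := by
    rw [h_def]
    field_simp
  have plateau : ∀ s ∈ Set.Icc (-h) h, Δ x₀ / 2 ≤ Δ (x₀ + h - s) := fun s hs => by
    have hdrop := hdec x₀ (x₀ + h - s) (by linarith [hs.2])
    have : m * (x₀ + h - s - x₀) ≤ m * (2 * h) :=
      mul_le_mul_of_nonneg_left (by linarith [hs.1]) hm.le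
    linarith
  have lower := (mul_sub_le_integral_mul_fejer (hΔ.comp (measurable_const.sub measurable_id))
    (fun s => hΔη _) ?_ hh plateau).trans (hκ (x₀ + h))
  · have tail_le : 2 * η * (8 / h) ≤ 128 * m := by
      calc 2 * η * (8 / h) ≤ 2 * (2 * Δ x₀) * (8 / h) := by gcongr
        _ = 128 * m := by
          rw [h_def]
          field_simp
          norm_num
    rw [div_mul_eq_mul_div, le_div_iff₀ integral_fejer_pos]
    linarith
  · rw [abs_of_pos (half_pos hx₀)]
    linarith [le_abs_self (Δ x₀), hΔη x₀]

lemma integral_neg_comp_neg_sub_mul_fejer (Δ : ℝ → ℝ) (x : ℝ) :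
    ∫ s, -Δ (-(x - s)) * fejer s = -∫ s, Δ (-x - s) * fejer s := by
  rw [← integral_neg, ← integral_neg_eq_self]
  refine integral_congr_ae (ae_of_all _ fun s => ?_)
  simp only [fejer_neg, neg_mul, sub_eq_add_neg, neg_add, neg_neg]

lemma abs_le_of_abs_integral_sub_mul_fejer_le {Δ : ℝ → ℝ} {η m κ x₀ : ℝ} (hm : 0 < m)
    (hΔ : Measurable Δ) (hΔη : ∀ x, |Δ x| ≤ η)
    (hdec : ∀ x y, x ≤ y → Δ x - m * (y - x) ≤ Δ y) (hx₀ : 0 < |Δ x₀|) (hη : η ≤ 2 * |Δ x₀|)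
    (hκ : ∀ x, |∫ s, Δ (x - s) * fejer s| ≤ κ) :
    |Δ x₀| ≤ 2 / (∫ s, fejer s) * (κ + 128 * m) := by
  rcases le_total 0 (Δ x₀) with hsign | hsign
  · rw [abs_of_nonneg hsign] at hx₀ hη ⊢
    exact le_of_integral_sub_mul_fejer_le hm hΔ hΔη hdec hx₀ hη
      fun x => (le_abs_self _).trans (hκ x)
  · have reflected := le_of_integral_sub_mul_fejer_le (Δ := fun x => -Δ (-x)) (η := η) (x₀ := -x₀)
      (κ := κ) hm (hΔ.comp measurable_neg).neg (fun x => by simpa using hΔη (-x))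
      (fun x y hxy => by linarith [hdec (-y) (-x) (neg_le_neg hxy)])
    simp only [neg_neg, ← abs_of_nonpos hsign] at reflected
    refine reflected hx₀ hη fun x => ?_
    rw [integral_neg_comp_neg_sub_mul_fejer]
    exact (neg_le_abs _).trans (hκ (-x))

theorem esseen_smoothing_inequality (ν γ : Measure ℝ) [IsProbabilityMeasure ν]
    [IsProbabilityMeasure γ] {G : ℝ → ℝ} (hG : IntervalIntegrable G volume (-1) 1)
    {m : ℝ} (hm : 0 < m) (hγ : ∀ x y, x ≤ y → cdf γ y - cdf γ x ≤ m * (y - x))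
    (hνγ : ∀ t ∈ Set.Icc (-1 : ℝ) 1, ‖charFun ν t - charFun γ t‖ ≤ |t| * G t) (x : ℝ) :
    |cdf ν x - cdf γ x| ≤ 4 / (∫ s, fejer s) * (2 * (∫ t in (-1 : ℝ)..1, G t) + 128 * m) := by
  set Δ : ℝ → ℝ := fun x => cdf ν x - cdf γ x with Δ_def
  have hΔ_bdd : BddAbove (Set.range fun x => |Δ x|) := by
    refine ⟨1, Set.forall_mem_range.2 fun x => ?_⟩
    exact abs_sub_le_of_nonneg_of_le (cdf_nonneg ν x) (cdf_le_one ν x) (cdf_nonneg γ x)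
      (cdf_le_one γ x)
  have hΔ_smooth (x : ℝ) : |∫ s, Δ (x - s) * fejer s| ≤ 2 * ∫ t in (-1 : ℝ)..1, G t := by
    simp_rw [Δ_def, sub_mul]
    rw [integral_sub (integrable_cdf_sub_mul_fejer ν x) (integrable_cdf_sub_mul_fejer γ x)]
    exact abs_smoothedCDF_sub_le ν γ hG hνγ x
  have hΔ_decay (x y : ℝ) (hxy : x ≤ y) : Δ x - m * (y - x) ≤ Δ y := by
    simp only [Δ_def]
    linarith [hγ x y hxy, monotone_cdf ν hxy]
  have hΔ_le (x : ℝ) : |Δ x| ≤ ⨆ x, |Δ x| := le_ciSup hΔ_bdd x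
  refine (hΔ_le x).trans ?_
  rcases ((abs_nonneg _).trans (hΔ_le x)).eq_or_lt with hsup | hsup
  · rw [← hsup]
    have := integral_fejer_pos
    have := (abs_nonneg _).trans (hΔ_smooth 0)
    positivity
  · obtain ⟨x₀, hx₀⟩ := exists_lt_of_lt_ciSup (half_lt_self hsup)
    have bound_at_x₀ := abs_le_of_abs_integral_sub_mul_fejer_le (Δ := Δ) (x₀ := x₀) hm
      ((monotone_cdf ν).measurable.sub (monotone_cdf γ).measurable) hΔ_le
      hΔ_decay (by linarith) (by linarith) hΔ_smooth
    calc ⨆ x, |Δ x| ≤ 2 * |Δ x₀| := by linarith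
      _ ≤ 2 * (2 / (∫ s, fejer s) * (2 * (∫ t in (-1 : ℝ)..1, G t) + 128 * m)) := by gcongr
      _ = _ := by ring

/-! ### Saddle points and the Cramér series -/

/-- Analytic functions on the disc of radius `R` that behave like the cumulant generating function
of a centred variable of variance one, with `A`-Lipschitz second derivative. The constraint
`A * R ≤ 1 / 2` keeps `φ''` within `1 / 2` of `1`, so that `φ'` is invertible. -/
structure IsNormalizedCGF (φ : ℂ → ℂ) (R A : ℝ) : Prop where
  radius_pos : 0 < R
  mul_radius_le : A * R ≤ 1 / 2
  differentiableOn : DifferentiableOn ℂ φ (Metric.ball 0 R)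
  map_zero : φ 0 = 0
  deriv_zero : deriv φ 0 = 0
  deriv_deriv_zero : deriv (deriv φ) 0 = 1
  lipschitz : ∀ z ∈ Metric.ball (0 : ℂ) R, ∀ w ∈ Metric.ball (0 : ℂ) R,
    ‖deriv (deriv φ) z - deriv (deriv φ) w‖ ≤ A * ‖z - w‖
  map_conj : ∀ z, φ (starRingEnd ℂ z) = starRingEnd ℂ (φ z)

/-- A right inverse `t` of `φ'` on the disc of radius `R / 4`, with values in the disc of radius
`R`: `t y` is the saddle point of `z ↦ φ z - z * y`. -/
def IsSaddleMap (φ : ℂ → ℂ) (R : ℝ) (t : ℂ → ℂ) : Prop :=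
  ∀ y ∈ Metric.ball (0 : ℂ) (R / 4), t y ∈ Metric.ball (0 : ℂ) R ∧ deriv φ (t y) = y

/-- `t` is the germ at `0` of an analytic local inverse of `φ'`. -/
structure IsSaddleGerm (φ t : ℂ → ℂ) : Prop where
  analyticAt : AnalyticAt ℂ t 0
  map_zero : t 0 = 0
  eventually_deriv_eq : ∀ᶠ y in 𝓝 0, deriv φ (t y) = y

/-- An analytic local inverse of `φ'` at `0`, arbitrary if there is none. -/
def saddleGerm (φ : ℂ → ℂ) : ℂ → ℂ := Classical.epsilon (IsSaddleGerm φ)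

/-- `y² / 2` minus the Legendre transform of `φ`, when `t` is the local inverse of `φ'`. -/
def legendreDefect (φ t : ℂ → ℂ) (y : ℂ) : ℂ := y ^ 2 / 2 - (t y * y - φ (t y))

/-- The coefficients `β_k` of the Cramér series of `φ`:
`y² / 2 - φ*(y) = y³ ∑ β_k y^k`, where `φ*` is the Legendre transform of `φ`. -/
def cramerCoeff (φ : ℂ → ℂ) (k : ℕ) : ℝ :=
  (iteratedDeriv (k + 3) (legendreDefect φ (saddleGerm φ)) 0).re / (k + 3).factorial

lemma deriv_conj_of_map_conj {f : ℂ → ℂ} (hf : ∀ z, f (starRingEnd ℂ z) = starRingEnd ℂ (f z))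
    (z : ℂ) : deriv f (starRingEnd ℂ z) = starRingEnd ℂ (deriv f z) := by
  have conj_comp : starRingEnd ℂ ∘ f ∘ starRingEnd ℂ = f := by
    ext w
    simp [hf]
  have deriv_eq := congrFun (deriv_conj_conj (f := f)) z
  rw [conj_comp] at deriv_eq
  simp [deriv_eq]

namespace IsNormalizedCGF

variable {φ : ℂ → ℂ} {R A : ℝ} (h : IsNormalizedCGF φ R A)
include h

lemma zero_mem : (0 : ℂ) ∈ Metric.ball (0 : ℂ) R := Metric.mem_ball_self h.radius_pos

lemma hasDerivAt {z : ℂ} (hz : z ∈ Metric.ball (0 : ℂ) R) : HasDerivAt φ (deriv φ z) z :=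
  (h.differentiableOn.differentiableAt (Metric.isOpen_ball.mem_nhds hz)).hasDerivAt

lemma hasDerivAt_deriv {z : ℂ} (hz : z ∈ Metric.ball (0 : ℂ) R) :
    HasDerivAt (deriv φ) (deriv (deriv φ) z) z :=
  ((h.differentiableOn.deriv Metric.isOpen_ball).differentiableAt
    (Metric.isOpen_ball.mem_nhds hz)).hasDerivAt

lemma deriv_conj (z : ℂ) : deriv φ (starRingEnd ℂ z) = starRingEnd ℂ (deriv φ z) :=
  deriv_conj_of_map_conj h.map_conj z

lemma deriv_deriv_conj (z : ℂ) :
    deriv (deriv φ) (starRingEnd ℂ z) = starRingEnd ℂ (deriv (deriv φ) z) :=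
  deriv_conj_of_map_conj h.deriv_conj z

lemma lipschitzConst_nonneg : 0 ≤ A := by
  have hR := h.radius_pos
  have mem : ((R / 2 : ℝ) : ℂ) ∈ Metric.ball (0 : ℂ) R := by
    rw [mem_ball_zero_iff, Complex.norm_real, Real.norm_of_nonneg (by positivity)]
    linarith
  refine nonneg_of_mul_nonneg_left ((norm_nonneg _).trans (h.lipschitz _ mem 0 h.zero_mem)) ?_
  rw [sub_zero, Complex.norm_real, Real.norm_of_nonneg (by positivity)]
  positivity

lemma norm_deriv_deriv_sub_one_le {z : ℂ} (hz : z ∈ Metric.ball (0 : ℂ) R) :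
    ‖deriv (deriv φ) z - 1‖ ≤ A * ‖z‖ := by
  simpa only [h.deriv_deriv_zero, sub_zero] using h.lipschitz z hz 0 h.zero_mem

lemma norm_deriv_deriv_sub_one_le_half {z : ℂ} (hz : z ∈ Metric.ball (0 : ℂ) R) :
    ‖deriv (deriv φ) z - 1‖ ≤ 1 / 2 := by
  refine (h.norm_deriv_deriv_sub_one_le hz).trans (le_trans ?_ h.mul_radius_le)
  exact mul_le_mul_of_nonneg_left (mem_ball_zero_iff.1 hz).le h.lipschitzConst_nonneg

lemma deriv_deriv_ne_zero {z : ℂ} (hz : z ∈ Metric.ball (0 : ℂ) R) : deriv (deriv φ) z ≠ 0 := by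
  intro hzero
  have := h.norm_deriv_deriv_sub_one_le_half hz
  norm_num [hzero] at this

lemma norm_deriv_sub_sub_le {z w : ℂ} (hz : z ∈ Metric.ball (0 : ℂ) R)
    (hw : w ∈ Metric.ball (0 : ℂ) R) :
    ‖deriv φ z - deriv φ w - (z - w)‖ ≤ 1 / 2 * ‖z - w‖ := by
  rw [sub_sub_sub_comm]
  exact (convex_ball (0 : ℂ) R).norm_image_sub_le_of_norm_hasDerivWithin_le
    (f := fun z => deriv φ z - z) (f' := fun z => deriv (deriv φ) z - 1)
    (fun x hx => ((h.hasDerivAt_deriv hx).sub (hasDerivAt_id x)).hasDerivWithinAt)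
    (fun x hx => h.norm_deriv_deriv_sub_one_le_half hx) hw hz

lemma norm_sub_le {z w : ℂ} (hz : z ∈ Metric.ball (0 : ℂ) R) (hw : w ∈ Metric.ball (0 : ℂ) R) :
    ‖z - w‖ ≤ 2 * ‖deriv φ z - deriv φ w‖ := by
  have close := h.norm_deriv_sub_sub_le hz hw
  have triangle := norm_sub_norm_le (z - w) (deriv φ z - deriv φ w)
  rw [norm_sub_rev (z - w) (deriv φ z - deriv φ w)] at triangle
  linarith

lemma norm_deriv_sub_self_le {z : ℂ} (hz : z ∈ Metric.ball (0 : ℂ) R) :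
    ‖deriv φ z - z‖ ≤ 1 / 2 * ‖z‖ := by
  simpa only [h.deriv_zero, sub_zero] using h.norm_deriv_sub_sub_le hz h.zero_mem

lemma norm_map_le {z : ℂ} (hz : z ∈ Metric.ball (0 : ℂ) R) : ‖φ z‖ ≤ 3 / 2 * R * ‖z‖ := by
  have norm_deriv_le : ∀ x ∈ Metric.ball (0 : ℂ) R, ‖deriv φ x‖ ≤ 3 / 2 * R := fun x hx => by
    linarith [h.norm_deriv_sub_self_le hx, norm_sub_norm_le (deriv φ x) x, mem_ball_zero_iff.1 hx]
  simpa only [h.map_zero, sub_zero] using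
    (convex_ball (0 : ℂ) R).norm_image_sub_le_of_norm_hasDerivWithin_le
      (fun x hx => (h.hasDerivAt hx).hasDerivWithinAt) norm_deriv_le h.zero_mem hz

lemma exists_isSaddleMap : ∃ t, IsSaddleMap φ R t := by
  have hR := h.radius_pos
  have approx : ApproximatesLinearOn (deriv φ)
      ((ContinuousLinearEquiv.refl ℂ ℂ : ℂ ≃L[ℂ] ℂ) : ℂ →L[ℂ] ℂ) (Metric.ball 0 R) (1 / 2) := by
    intro x hx y hy
    simpa using h.norm_deriv_sub_sub_le hx hy
  let inv : ((ContinuousLinearEquiv.refl ℂ ℂ : ℂ ≃L[ℂ] ℂ) : ℂ →L[ℂ] ℂ).NonlinearRightInverse :=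
    { toFun := id, nnnorm := 1, bound' := by simp, right_inv' := by simp }
  have surj := approx.surjOn_closedBall_of_nonlinearRightInverse inv (ε := R / 2) (b := 0)
    (by positivity) (Metric.closedBall_subset_ball (by linarith))
  have radius_eq : (((inv.nnnorm : ℝ))⁻¹ - ((1 / 2 : NNReal) : ℝ)) * (R / 2) = R / 4 := by
    norm_num [inv]
    ring
  rw [radius_eq, h.deriv_zero] at surj
  choose! t ht using fun y (hy : y ∈ Metric.ball (0 : ℂ) (R / 4)) =>
    surj (Metric.ball_subset_closedBall hy)
  exact ⟨t, fun y hy =>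
    ⟨Metric.closedBall_subset_ball (by linarith) (ht y hy).1, (ht y hy).2⟩⟩

lemma saddleGerm_eventuallyEq {t : ℂ → ℂ} (ht : IsSaddleGerm φ t) : saddleGerm φ =ᶠ[𝓝 0] t := by
  have hs : IsSaddleGerm φ (saddleGerm φ) := Classical.epsilon_spec ⟨t, ht⟩
  have strict : HasStrictDerivAt (deriv φ) 1 0 := by
    rw [← h.deriv_deriv_zero]
    exact (h.differentiableOn.analyticAt
      (Metric.ball_mem_nhds 0 h.radius_pos)).deriv.hasStrictDerivAt
  have left_inverse := strict.eventually_left_inverse one_ne_zero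
  have tendsto_zero {u : ℂ → ℂ} (hu : IsSaddleGerm φ u) : Tendsto u (𝓝 0) (𝓝 0) := by
    simpa only [ContinuousAt, hu.map_zero] using hu.analyticAt.continuousAt
  filter_upwards [(tendsto_zero hs).eventually left_inverse,
    (tendsto_zero ht).eventually left_inverse, hs.eventually_deriv_eq, ht.eventually_deriv_eq]
    with y inv_s inv_t deriv_s deriv_t
  rw [← inv_s, ← inv_t, deriv_s, deriv_t]

lemma zero_mem_quarter : (0 : ℂ) ∈ Metric.ball (0 : ℂ) (R / 4) :=
  Metric.mem_ball_self (div_pos h.radius_pos four_pos)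

section SaddleMap

variable {t : ℂ → ℂ} (ht : IsSaddleMap φ R t)
include ht

lemma norm_saddle_sub_le {x y : ℂ} (hx : x ∈ Metric.ball (0 : ℂ) (R / 4))
    (hy : y ∈ Metric.ball (0 : ℂ) (R / 4)) : ‖t x - t y‖ ≤ 2 * ‖x - y‖ := by
  simpa only [(ht x hx).2, (ht y hy).2] using h.norm_sub_le (ht x hx).1 (ht y hy).1

lemma saddle_zero : t 0 = 0 := by
  have hzero := ht 0 h.zero_mem_quarter
  simpa [hzero.2, h.deriv_zero] using h.norm_sub_le hzero.1 h.zero_mem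

lemma hasDerivAt_saddle {y : ℂ} (hy : y ∈ Metric.ball (0 : ℂ) (R / 4)) :
    HasDerivAt t (deriv (deriv φ) (t y))⁻¹ y := by
  have hnhds : Metric.ball (0 : ℂ) (R / 4) ∈ 𝓝 y := Metric.isOpen_ball.mem_nhds hy
  refine HasDerivAt.of_local_left_inverse (f := deriv φ) ?_ (h.hasDerivAt_deriv (ht y hy).1)
    (h.deriv_deriv_ne_zero (ht y hy).1) ?_
  · have lipschitz : LipschitzOnWith 2 t (Metric.ball (0 : ℂ) (R / 4)) :=
      LipschitzOnWith.of_dist_le_mul fun x hx y hy => by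
        simpa only [dist_eq_norm, NNReal.coe_ofNat] using h.norm_saddle_sub_le ht hx hy
    exact lipschitz.continuousOn.continuousAt hnhds
  · filter_upwards [hnhds] with x hx using (ht x hx).2

lemma isSaddleGerm : IsSaddleGerm φ t where
  analyticAt := DifferentiableOn.analyticAt
    (fun _ hy => (h.hasDerivAt_saddle ht hy).differentiableAt.differentiableWithinAt)
    (Metric.isOpen_ball.mem_nhds h.zero_mem_quarter)
  map_zero := h.saddle_zero ht
  eventually_deriv_eq := by
    filter_upwards [Metric.isOpen_ball.mem_nhds h.zero_mem_quarter] with y hy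
    exact (ht y hy).2

lemma cramerCoeff_eq (k : ℕ) :
    cramerCoeff φ k = (iteratedDeriv (k + 3) (legendreDefect φ t) 0).re / (k + 3).factorial := by
  have defect_eq : legendreDefect φ (saddleGerm φ) =ᶠ[𝓝 0] legendreDefect φ t := by
    filter_upwards [h.saddleGerm_eventuallyEq (h.isSaddleGerm ht)] with y hy
    simp only [legendreDefect, hy]
  rw [cramerCoeff, defect_eq.iteratedDeriv_eq]

lemma hasDerivAt_legendreDefect {y : ℂ} (hy : y ∈ Metric.ball (0 : ℂ) (R / 4)) :
    HasDerivAt (legendreDefect φ t) (y - t y) y := by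
  have deriv_t := h.hasDerivAt_saddle ht hy
  have deriv_φ_t := (h.hasDerivAt (ht y hy).1).comp y deriv_t
  rw [(ht y hy).2] at deriv_φ_t
  have deriv_defect := (((hasDerivAt_id y).pow 2).div_const 2).sub
    ((deriv_t.mul (hasDerivAt_id y)).sub deriv_φ_t)
  convert! deriv_defect using 1
  simp only [id]
  ring

lemma differentiableOn_legendreDefect :
    DifferentiableOn ℂ (legendreDefect φ t) (Metric.ball 0 (R / 4)) :=
  fun _ hy => (h.hasDerivAt_legendreDefect ht hy).differentiableAt.differentiableWithinAt

lemma norm_legendreDefect_le {y : ℂ} (hy : y ∈ Metric.ball (0 : ℂ) (R / 4)) :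
    ‖legendreDefect φ t y‖ ≤ 2 * R ^ 2 := by
  have hR := h.radius_pos
  have norm_ty := (mem_ball_zero_iff.1 (ht y hy).1).le
  have norm_y := (mem_ball_zero_iff.1 hy).le
  calc ‖legendreDefect φ t y‖
      ≤ ‖y ^ 2 / 2‖ + (‖t y * y‖ + ‖φ (t y)‖) :=
        (_root_.norm_sub_le _ _).trans (add_le_add_right (_root_.norm_sub_le _ _) _)
    _ ≤ (R / 4) ^ 2 / 2 + (R * (R / 4) + 3 / 2 * R * R) := by
        rw [norm_div, norm_pow, norm_mul, Complex.norm_ofNat]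
        gcongr
        exact (h.norm_map_le (ht y hy).1).trans (by gcongr)
    _ ≤ 2 * R ^ 2 := by linarith [sq_nonneg R]

lemma sum_range_three_taylor_legendreDefect (y : ℂ) :
    ∑ n ∈ Finset.range 3,
      (n.factorial : ℂ)⁻¹ • y ^ n • iteratedDeriv n (legendreDefect φ t) 0 = 0 := by
  have deriv_eq : deriv (legendreDefect φ t) =ᶠ[𝓝 0] fun y => y - t y := by
    filter_upwards [Metric.isOpen_ball.mem_nhds h.zero_mem_quarter] with y hy
    exact (h.hasDerivAt_legendreDefect ht hy).deriv
  have deriv_t := h.hasDerivAt_saddle ht h.zero_mem_quarter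
  rw [h.saddle_zero ht, h.deriv_deriv_zero] at deriv_t
  have deriv_two : iteratedDeriv 2 (legendreDefect φ t) 0 = 0 := by
    rw [iteratedDeriv_succ, iteratedDeriv_one, deriv_eq.deriv_eq]
    simpa using ((hasDerivAt_id' (0 : ℂ)).fun_sub deriv_t).deriv
  simp [Finset.sum_range_succ, deriv_two, deriv_eq.self_of_nhds, h.saddle_zero ht, h.map_zero,
    legendreDefect]

lemma norm_iteratedDeriv_legendreDefect_le (n : ℕ) :
    ‖iteratedDeriv n (legendreDefect φ t) 0‖ ≤ n.factorial * (2 * R ^ 2) / (R / 8) ^ n := by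
  have hR := h.radius_pos
  have closedBall_subset : Metric.closedBall (0 : ℂ) (R / 8) ⊆ Metric.ball 0 (R / 4) :=
    Metric.closedBall_subset_ball (by linarith)
  refine Complex.norm_iteratedDeriv_le_of_forall_mem_sphere_norm_le n (by positivity) ?_
    fun z hz => h.norm_legendreDefect_le ht (closedBall_subset (Metric.sphere_subset_closedBall hz))
  refine DifferentiableOn.diffContOnCl ((h.differentiableOn_legendreDefect ht).mono ?_)
  exact Metric.closure_ball_subset_closedBall.trans closedBall_subset

end SaddleMap

lemma abs_cramerCoeff_le (k : ℕ) : |cramerCoeff φ k| ≤ 2 * R ^ 2 / (R / 8) ^ (k + 3) := by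
  obtain ⟨t, ht⟩ := h.exists_isSaddleMap
  rw [h.cramerCoeff_eq ht, abs_div, Nat.abs_cast, div_le_iff₀ (by positivity)]
  refine (Complex.abs_re_le_norm _).trans
    ((h.norm_iteratedDeriv_legendreDefect_le ht _).trans (le_of_eq ?_))
  ring

lemma norm_cramerCoeff_mul_pow_le {z : ℂ} (hz : ‖z‖ ≤ R / 16) (k : ℕ) :
    ‖(cramerCoeff φ k : ℂ) * z ^ k‖ ≤ 1024 / R * (1 / 2) ^ k := by
  have hR := h.radius_pos
  rw [norm_mul, norm_pow, Complex.norm_real, Real.norm_eq_abs]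
  calc |cramerCoeff φ k| * ‖z‖ ^ k ≤ 2 * R ^ 2 / (R / 8) ^ (k + 3) * (R / 8 * (1 / 2)) ^ k := by
        gcongr
        · exact h.abs_cramerCoeff_le k
        · linarith
    _ = 1024 / R * (1 / 2) ^ k := by
        rw [pow_add, mul_pow]
        field_simp
        norm_num

lemma summable_cramerCoeff_mul_pow {z : ℂ} (hz : ‖z‖ ≤ R / 16) :
    Summable fun k => (cramerCoeff φ k : ℂ) * z ^ k :=
  .of_norm_bounded (summable_geometric_two.mul_left _) (h.norm_cramerCoeff_mul_pow_le hz)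

lemma norm_tsum_cramerCoeff_mul_pow_le {z : ℂ} (hz : ‖z‖ ≤ R / 16) :
    ‖∑' k, (cramerCoeff φ k : ℂ) * z ^ k‖ ≤ 2048 / R := by
  refine (tsum_of_norm_bounded (hasSum_geometric_two.mul_left _)
    (h.norm_cramerCoeff_mul_pow_le hz)).trans_eq ?_
  ring

lemma legendreDefect_re_eq {t : ℂ → ℂ} (ht : IsSaddleMap φ R t) {y : ℝ}
    (hy : (y : ℂ) ∈ Metric.ball (0 : ℂ) (R / 4)) :
    (legendreDefect φ t y).re = y ^ 3 * ∑' k, cramerCoeff φ k * y ^ k := by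
  have taylor := Complex.hasSum_taylorSeries_on_ball (h.differentiableOn_legendreDefect ht) hy
  simp only [sub_zero] at taylor
  rw [← hasSum_nat_add_iff' 3, h.sum_range_three_taylor_legendreDefect ht, sub_zero] at taylor
  have term_re (k : ℕ) : (((k + 3).factorial : ℂ)⁻¹ • (y : ℂ) ^ (k + 3) •
      iteratedDeriv (k + 3) (legendreDefect φ t) 0).re = y ^ 3 * (cramerCoeff φ k * y ^ k) := by
    rw [h.cramerCoeff_eq ht, smul_eq_mul, smul_eq_mul, ← mul_assoc,
      ← Complex.ofReal_natCast, ← Complex.ofReal_inv, ← Complex.ofReal_pow, ← Complex.ofReal_mul,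
      Complex.re_ofReal_mul]
    ring
  rw [← tsum_mul_left, ← (Complex.hasSum_re taylor).tsum_eq]
  exact tsum_congr term_re

lemma conj_saddle_eq {t : ℂ → ℂ} (ht : IsSaddleMap φ R t) {y : ℝ}
    (hy : (y : ℂ) ∈ Metric.ball (0 : ℂ) (R / 4)) : starRingEnd ℂ (t y) = t y := by
  have mem : starRingEnd ℂ (t y) ∈ Metric.ball (0 : ℂ) R := by
    simpa only [mem_ball_zero_iff, RCLike.norm_conj] using (ht y hy).1
  have dist_le := h.norm_sub_le mem (ht y hy).1
  rw [h.deriv_conj, (ht y hy).2, Complex.conj_ofReal, sub_self, norm_zero, mul_zero] at dist_le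
  exact sub_eq_zero.1 (norm_le_zero_iff.1 dist_le)

theorem exists_real_saddle {y : ℝ} (hy0 : 0 ≤ y) (hyR : y < R / 4) :
    ∃ s : ℝ, 0 ≤ s ∧ s ≤ 2 * y ∧ deriv φ s = y ∧
      s * y - (φ s).re = y ^ 2 / 2 - y ^ 3 * ∑' k, cramerCoeff φ k * y ^ k := by
  obtain ⟨t, ht⟩ := h.exists_isSaddleMap
  have hy : (y : ℂ) ∈ Metric.ball (0 : ℂ) (R / 4) := by
    rwa [mem_ball_zero_iff, Complex.norm_real, Real.norm_of_nonneg hy0]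
  obtain ⟨s, hs⟩ := Complex.conj_eq_iff_real.1 (h.conj_saddle_eq ht hy)
  have dist_le : |y - s| ≤ 1 / 2 * |s| := by
    have := h.norm_deriv_sub_self_le (ht y hy).1
    rwa [(ht y hy).2, hs, ← Complex.ofReal_sub, Complex.norm_real, Complex.norm_real] at this
  have hs0 : 0 ≤ s := by
    by_contra! hneg
    rw [abs_of_neg hneg] at dist_le
    linarith [(abs_le.1 dist_le).2]
  rw [abs_of_nonneg hs0, abs_le] at dist_le
  refine ⟨s, hs0, by linarith, hs ▸ (ht y hy).2, ?_⟩
  rw [← h.legendreDefect_re_eq ht hy, legendreDefect, hs]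
  have sq_re : ((y : ℂ) ^ 2 / 2).re = y ^ 2 / 2 := by norm_cast
  simp [sq_re]

end IsNormalizedCGF

/-! ### The Mills ratio -/

/-- The Mills ratio `exp (θ² / 2) (1 - Φ θ)`, in its form as a Laplace transform. -/
def mills (θ : ℝ) : ℝ := ∫ z in Set.Ioi 0, Real.exp (-(θ * z)) ∂gaussianReal 0 1

lemma integrable_exp_neg_mul_gaussianReal (θ : ℝ) (v : NNReal) :
    Integrable (fun z => Real.exp (-(θ * z))) (gaussianReal 0 v) := by
  simpa using integrable_exp_mul_gaussianReal (μ := 0) (v := v) (-θ)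

lemma mills_pos (θ : ℝ) : 0 < mills θ := by
  have support_eq : Function.support (fun z : ℝ => Real.exp (-(θ * z))) = Set.univ :=
    Set.eq_univ_of_forall fun z => (Real.exp_pos _).ne'
  rw [mills, setIntegral_pos_iff_support_of_nonneg_ae (ae_of_all _ fun z => (Real.exp_pos _).le)
    (integrable_exp_neg_mul_gaussianReal θ 1).integrableOn, support_eq, Set.univ_inter,
    gaussianReal_apply _ one_ne_zero, setLIntegral_pos_iff (measurable_gaussianPDF _ _),
    support_gaussianPDF one_ne_zero]
  simp

lemma mills_antitone : Antitone mills := fun a b hab => by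
  refine setIntegral_mono_on (integrable_exp_neg_mul_gaussianReal b 1).integrableOn
    (integrable_exp_neg_mul_gaussianReal a 1).integrableOn measurableSet_Ioi fun z hz => ?_
  have : 0 < z := hz
  gcongr

lemma mills_eq_integral_gaussianPDFReal (θ : ℝ) :
    mills θ = ∫ z in Set.Ioi 0, gaussianPDFReal 0 1 z * Real.exp (-(θ * z)) := by
  rw [mills, gaussianReal_of_var_ne_zero _ one_ne_zero,
    setIntegral_withDensity_eq_setIntegral_toReal_smul (measurable_gaussianPDF _ _)
      (ae_of_all _ fun _ => gaussianPDF_lt_top) _ measurableSet_Ioi]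
  simp only [toReal_gaussianPDF, smul_eq_mul]

lemma integrable_gaussianPDFReal_mul_exp (θ : ℝ) :
    Integrable (fun z => gaussianPDFReal 0 1 z * Real.exp (-(θ * z))) := by
  have := integrable_exp_neg_mul_gaussianReal θ 1
  rw [gaussianReal_of_var_ne_zero _ one_ne_zero,
    integrable_withDensity_iff_integrable_smul' (measurable_gaussianPDF _ _)
      (ae_of_all _ fun _ => gaussianPDF_lt_top)] at this
  simpa [toReal_gaussianPDF] using this

lemma gaussianPDFReal_mul_le {r z : ℝ} (hr : 1 ≤ r) (hz : 0 ≤ z) :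
    gaussianPDFReal 0 1 (r * z) ≤ gaussianPDFReal 0 1 z := by
  have : z ≤ r * z := le_mul_of_one_le_left hz hr
  simp only [gaussianPDFReal, sub_zero]
  gcongr

lemma mills_le_div_mul {a b : ℝ} (ha : 0 < a) (hab : a ≤ b) : mills a ≤ b / a * mills b := by
  have hr : 0 < b / a := div_pos (ha.trans_le hab) ha
  have rescale := integral_comp_mul_left_Ioi
    (fun z => gaussianPDFReal 0 1 z * Real.exp (-(a * z))) 0 hr
  rw [mul_zero, ← mills_eq_integral_gaussianPDFReal, smul_eq_mul, eq_inv_mul_iff_mul_eq₀ hr.ne']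
    at rescale
  rw [← rescale, mills_eq_integral_gaussianPDFReal b]
  refine mul_le_mul_of_nonneg_left (setIntegral_mono_on
    ((integrable_gaussianPDFReal_mul_exp a).comp_mul_left' hr.ne').integrableOn
    (integrable_gaussianPDFReal_mul_exp b).integrableOn measurableSet_Ioi fun z hz => ?_) hr.le
  rw [show a * (b / a * z) = b * z by field_simp]
  gcongr
  exact gaussianPDFReal_mul_le ((one_le_div ha).2 hab) (Set.mem_Ioi.1 hz).le

lemma measureReal_Ioi_eq_one_sub_cdf (μ : Measure ℝ) [IsProbabilityMeasure μ] (x : ℝ) :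
    μ.real (Set.Ioi x) = 1 - cdf μ x := by
  rw [cdf_eq_real, ← probReal_compl_eq_one_sub measurableSet_Iic, Set.compl_Iic]

lemma measureReal_Ioc_eq_cdf_sub (μ : Measure ℝ) [IsProbabilityMeasure μ] {x y : ℝ}
    (hxy : x ≤ y) : μ.real (Set.Ioc x y) = cdf μ y - cdf μ x := by
  rw [cdf_eq_real, cdf_eq_real, ← measureReal_sdiff (Set.Iic_subset_Iic.2 hxy) measurableSet_Iic,
    Set.Iic_sdiff_Iic]

lemma gaussianReal_real_eq_integral (μ : ℝ) {v : NNReal} (hv : v ≠ 0) (s : Set ℝ) :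
    (gaussianReal μ v).real s = ∫ z in s, gaussianPDFReal μ v z := by
  rw [measureReal_def, gaussianReal_apply_eq_integral _ hv,
    ENNReal.toReal_ofReal (integral_nonneg fun z => gaussianPDFReal_nonneg _ _ _)]

lemma one_sub_stdNormalCDF (x : ℝ) :
    1 - stdNormalCDF x = Real.exp (-(x ^ 2 / 2)) * mills x := by
  have shift := (measurePreserving_add_right volume x).setIntegral_preimage_emb
    (measurableEmbedding_addRight x) (gaussianPDFReal 0 1) (Set.Ioi x)
  rw [Set.preimage_add_const_Ioi, sub_self] at shift
  rw [stdNormalCDF, ← measureReal_Ioi_eq_one_sub_cdf, gaussianReal_real_eq_integral _ one_ne_zero,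
    ← shift, mills_eq_integral_gaussianPDFReal, ← integral_const_mul]
  congr 1 with z
  simp only [gaussianPDFReal, sub_zero, NNReal.coe_one, mul_one]
  rw [mul_assoc, mul_left_comm, ← Real.exp_add, ← Real.exp_add]
  ring_nf

lemma one_sub_stdNormalCDF_pos (x : ℝ) : 0 < 1 - stdNormalCDF x := by
  rw [one_sub_stdNormalCDF]
  exact mul_pos (Real.exp_pos _) (mills_pos _)

lemma mills_one_div_one_add_le {x : ℝ} (hx : 0 ≤ x) : mills 1 / (1 + x) ≤ mills x := by
  rcases le_total x 1 with hx1 | hx1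
  · exact (div_le_self (mills_pos 1).le (by linarith)).trans (mills_antitone hx1)
  · rw [div_le_iff₀ (by linarith)]
    calc mills 1 ≤ x / 1 * mills x := mills_le_div_mul one_pos hx1
      _ ≤ mills x * (1 + x) := by linarith [mills_pos x]

lemma abs_mills_div_sub_one_le {θ x e : ℝ} (hx : 0 < x) (he : e ≤ 1 / 2)
    (hθx : |θ / x - 1| ≤ e) : |mills θ / mills x - 1| ≤ 2 * e := by
  have he0 : 0 ≤ e := (abs_nonneg _).trans hθx
  obtain ⟨ratio_lower, ratio_upper⟩ := abs_le.1 hθx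
  have θ_lower : (1 - e) * x ≤ θ := by rw [← le_div_iff₀ hx]; linarith
  have θ_upper : θ ≤ (1 + e) * x := by rw [← div_le_iff₀ hx]; linarith
  have hθ : 0 < θ := (mul_pos (by linarith) hx).trans_le θ_lower
  have hmx := mills_pos x
  have hmθ := mills_pos θ
  rw [div_sub_one hmx.ne', abs_div, abs_of_pos hmx, div_le_iff₀ hmx, abs_le]
  rcases le_total x θ with hxθ | hθx
  · have anti := mills_antitone hxθ
    have lower : mills x ≤ (1 + e) * mills θ := (mills_le_div_mul hx hxθ).trans
      (mul_le_mul_of_nonneg_right ((div_le_iff₀ hx).2 θ_upper) hmθ.le)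
    constructor <;> nlinarith
  · have anti := mills_antitone hθx
    have inv_ratio : x / θ ≤ 1 + 2 * e := by
      rw [div_le_iff₀ hθ]
      calc x ≤ (1 + 2 * e) * ((1 - e) * x) := by nlinarith [mul_nonneg he0 hx.le]
        _ ≤ (1 + 2 * e) * θ := by gcongr
    have upper : mills θ ≤ (1 + 2 * e) * mills x := (mills_le_div_mul hθ hθx).trans
      (mul_le_mul_of_nonneg_right inv_ratio hmx.le)
    constructor <;> nlinarith

/-! ### Laplace transforms and distribution functions -/

lemma abs_integral_sub_integral_le_of_superlevel {α : Type*} [MeasurableSpace α]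
    (μ ν : Measure α) [IsProbabilityMeasure μ] [IsProbabilityMeasure ν] {f : α → ℝ} {δ : ℝ}
    (hf : Measurable f) (hf01 : ∀ a, f a ∈ Set.Icc (0 : ℝ) 1)
    (hδ : ∀ t ∈ Set.Ioc (0 : ℝ) 1, |μ.real {a | t ≤ f a} - ν.real {a | t ≤ f a}| ≤ δ) :
    |∫ a, f a ∂μ - ∫ a, f a ∂ν| ≤ δ := by
  have layerCake (ρ : Measure α) [IsProbabilityMeasure ρ] :
      ∫ a, f a ∂ρ = ∫ t in Set.Ioc 0 1, ρ.real {a | t ≤ f a} := by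
    refine Integrable.integral_eq_integral_Ioc_meas_le ?_ (ae_of_all _ fun a => (hf01 a).1)
      (ae_of_all _ fun a => (hf01 a).2)
    refine Integrable.of_bound hf.aestronglyMeasurable 1 (ae_of_all _ fun a => ?_)
    rw [Real.norm_of_nonneg (hf01 a).1]
    exact (hf01 a).2
  have hint (ρ : Measure α) [IsProbabilityMeasure ρ] :
      IntegrableOn (fun t => ρ.real {a | t ≤ f a}) (Set.Ioc 0 1) := by
    have hanti : Antitone fun t => ρ.real {a | t ≤ f a} := fun t t' htt' =>
      measureReal_mono fun a (ha : t' ≤ f a) => htt'.trans ha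
    refine Measure.integrableOn_of_bounded (M := 1) (by simp)
      hanti.measurable.aestronglyMeasurable (ae_of_all _ fun t => ?_)
    rw [Real.norm_of_nonneg measureReal_nonneg]
    exact measureReal_le_one
  rw [layerCake μ, layerCake ν, ← integral_sub (hint μ) (hint ν), ← Real.norm_eq_abs]
  simpa using norm_setIntegral_le_of_norm_le_const (μ := volume) (s := Set.Ioc (0 : ℝ) 1)
    (f := fun t => μ.real {a | t ≤ f a} - ν.real {a | t ≤ f a}) (by simp) hδ

lemma superlevel_indicator_Ioi_exp {κ t : ℝ} (hκ : 0 ≤ κ) (ht : t ∈ Set.Ioc (0 : ℝ) 1) :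
    {w | t ≤ (Set.Ioi (0 : ℝ)).indicator (fun w => Real.exp (-(κ * w))) w} = Set.Ioi 0 ∨
      ∃ c, 0 ≤ c ∧
        {w | t ≤ (Set.Ioi (0 : ℝ)).indicator (fun w => Real.exp (-(κ * w))) w} = Set.Ioc 0 c := by
  have mem_iff (w : ℝ) : t ≤ (Set.Ioi (0 : ℝ)).indicator (fun w => Real.exp (-(κ * w))) w ↔
      0 < w ∧ κ * w ≤ -Real.log t := by
    rw [le_neg, Real.log_le_iff_le_exp ht.1]
    by_cases hw : 0 < w
    · simp [hw]
    · simp [hw, ht.1]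
  simp only [mem_iff]
  have hlog : 0 ≤ -Real.log t := neg_nonneg.2 (Real.log_nonpos ht.1.le ht.2)
  rcases hκ.eq_or_lt with rfl | hκ
  · left
    ext w
    simp only [zero_mul, hlog, and_true, Set.mem_ofPred_eq, Set.mem_Ioi]
  · refine Or.inr ⟨-Real.log t / κ, div_nonneg hlog hκ.le, ?_⟩
    ext w
    simp only [Set.mem_ofPred_eq, Set.mem_Ioc, le_div_iff₀' hκ]

lemma abs_setIntegral_exp_sub_le (μ ν : Measure ℝ) [IsProbabilityMeasure μ]
    [IsProbabilityMeasure ν] {η κ : ℝ} (hκ : 0 ≤ κ) (hη : ∀ x, |cdf μ x - cdf ν x| ≤ η) :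
    |(∫ w in Set.Ioi 0, Real.exp (-(κ * w)) ∂μ) - ∫ w in Set.Ioi 0, Real.exp (-(κ * w)) ∂ν|
      ≤ 2 * η := by
  rw [← integral_indicator measurableSet_Ioi, ← integral_indicator measurableSet_Ioi]
  refine abs_integral_sub_integral_le_of_superlevel μ ν
    (Measurable.indicator (by fun_prop) measurableSet_Ioi) (fun w => ?_) fun t ht => ?_
  · refine ⟨Set.indicator_nonneg (fun _ _ => (Real.exp_pos _).le) w,
      Set.indicator_le' (fun w hw => ?_) (fun _ _ => zero_le_one) w⟩
    exact Real.exp_le_one_iff.2 (neg_nonpos.2 (mul_nonneg hκ (Set.mem_Ioi.1 hw).le))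
  · obtain ⟨lower₀, upper₀⟩ := abs_le.1 (hη 0)
    rcases superlevel_indicator_Ioi_exp hκ ht with hset | ⟨c, hc, hset⟩
    · rw [hset, measureReal_Ioi_eq_one_sub_cdf, measureReal_Ioi_eq_one_sub_cdf, abs_le]
      constructor <;> linarith
    · obtain ⟨lower, upper⟩ := abs_le.1 (hη c)
      rw [hset, measureReal_Ioc_eq_cdf_sub _ hc, measureReal_Ioc_eq_cdf_sub _ hc, abs_le]
      constructor <;> linarith

lemma setIntegral_exp_gaussianReal (κ : ℝ) {v : NNReal} (hv : v ≠ 0) :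
    ∫ w in Set.Ioi 0, Real.exp (-(κ * w)) ∂gaussianReal 0 v = mills (κ * √v) := by
  have hsqrt : 0 < √(v : ℝ) := Real.sqrt_pos.2 (NNReal.coe_pos.2 (pos_iff_ne_zero.2 hv))
  have scaling : gaussianReal 0 v = (gaussianReal 0 1).map (√(v : ℝ) * ·) := by
    rw [gaussianReal_map_const_mul]
    congr 1
    · simp
    · ext; simp
  rw [scaling, setIntegral_map measurableSet_Ioi (by fun_prop) (by fun_prop),
    Set.preimage_const_mul_Ioi₀ _ hsqrt, zero_div, mills]
  simp only [mul_assoc]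

lemma gaussianPDFReal_le_inv_sqrt (μ : ℝ) (v : NNReal) (z : ℝ) :
    gaussianPDFReal μ v z ≤ (√v)⁻¹ := by
  rcases eq_or_ne v 0 with rfl | hv
  · simp
  have hv0 : (0 : ℝ) < v := NNReal.coe_pos.2 (pos_iff_ne_zero.2 hv)
  have exp_le_one : Real.exp (-(z - μ) ^ 2 / (2 * v)) ≤ 1 := by
    rw [Real.exp_le_one_iff, neg_div, neg_nonpos]
    positivity
  refine (mul_le_of_le_one_right (by positivity) exp_le_one).trans
    (inv_anti₀ (Real.sqrt_pos.2 hv0) (Real.sqrt_le_sqrt ?_))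
  exact le_mul_of_one_le_left hv0.le (by linarith [Real.pi_gt_three])

lemma cdf_gaussianReal_sub_le (μ : ℝ) {v : NNReal} (hv : v ≠ 0) {x y : ℝ} (hxy : x ≤ y) :
    cdf (gaussianReal μ v) y - cdf (gaussianReal μ v) x ≤ (√v)⁻¹ * (y - x) := by
  rw [← measureReal_Ioc_eq_cdf_sub _ hxy, gaussianReal_real_eq_integral _ hv]
  have := norm_setIntegral_le_of_norm_le_const (μ := volume) (s := Set.Ioc x y)
    (f := gaussianPDFReal μ v) (C := (√v)⁻¹) (by simp) fun z _ => by
      rw [Real.norm_of_nonneg (gaussianPDFReal_nonneg _ _ _)]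
      exact gaussianPDFReal_le_inv_sqrt μ v z
  rw [Real.volume_real_Ioc_of_le hxy] at this
  exact (le_abs_self _).trans this

/-! ### Exponential tilting -/

/-- `ν` has cumulant generating function `V φ` on the disc of radius `R`. -/
def HasCGFOnBall (ν : Measure ℝ) (V : ℝ) (φ : ℂ → ℂ) (R : ℝ) : Prop :=
  ∀ z ∈ Metric.ball (0 : ℂ) R, Integrable (fun x : ℝ => Complex.exp (z * x)) ν ∧
    ∫ x : ℝ, Complex.exp (z * x) ∂ν = Complex.exp (V * φ z)

/-- The law of `c (X - m)` when `X` has the exponentially tilted law `exp (s x) ν(dx)`,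
normalized. -/
def tiltedLaw (ν : Measure ℝ) (s c m : ℝ) : Measure ℝ :=
  (ν.tilted fun x => s * x).map fun x => c * (x - m)

namespace HasCGFOnBall

variable {ν : Measure ℝ} {V R : ℝ} {φ : ℂ → ℂ} (h : HasCGFOnBall ν V φ R)
include h

lemma mono {r : ℝ} (hr : r ≤ R) : HasCGFOnBall ν V φ r :=
  fun z hz => h z (Metric.ball_subset_ball hr hz)

lemma integrable_exp {s : ℝ} (hs : (s : ℂ) ∈ Metric.ball (0 : ℂ) R) :
    Integrable (fun x : ℝ => Real.exp (s * x)) ν := by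
  refine (h s hs).1.norm.congr (ae_of_all _ fun x => ?_)
  simp only [Complex.norm_exp, ← Complex.ofReal_mul, Complex.ofReal_re]

lemma ofReal_integral_exp {s : ℝ} (hs : (s : ℂ) ∈ Metric.ball (0 : ℂ) R) :
    ((∫ x : ℝ, Real.exp (s * x) ∂ν : ℝ) : ℂ) = Complex.exp (V * φ s) := by
  rw [← (h s hs).2, ← integral_complex_ofReal]
  simp only [Complex.ofReal_exp, Complex.ofReal_mul]

lemma integral_exp {s : ℝ} (hs : (s : ℂ) ∈ Metric.ball (0 : ℂ) R) :
    ∫ x : ℝ, Real.exp (s * x) ∂ν = Real.exp (V * (φ s).re) := by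
  have norm_eq := congrArg norm (h.ofReal_integral_exp hs)
  rwa [Complex.norm_real, Real.norm_of_nonneg (integral_nonneg fun x => (Real.exp_pos _).le),
    Complex.norm_exp, Complex.re_ofReal_mul] at norm_eq

lemma charFun_tiltedLaw {s : ℝ} (hs : (s : ℂ) ∈ Metric.ball (0 : ℂ) R) (c m t : ℝ)
    (hst : (s : ℂ) + (c * t : ℝ) * Complex.I ∈ Metric.ball (0 : ℂ) R) :
    charFun (tiltedLaw ν s c m) t
      = Complex.exp
        (V * (φ (s + (c * t : ℝ) * Complex.I) - φ s) - (c * t * m : ℝ) * Complex.I) := by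
  have integrand_eq (x : ℝ) :
      (Real.exp (s * x) / ∫ x : ℝ, Real.exp (s * x) ∂ν) •
          Complex.exp (t * ((c * (x - m) : ℝ) : ℂ) * Complex.I)
        = Complex.exp (-(V * φ s) - (c * t * m : ℝ) * Complex.I) *
          Complex.exp ((s + (c * t : ℝ) * Complex.I) * x) := by
    rw [Complex.real_smul, Complex.ofReal_div, h.ofReal_integral_exp hs, Complex.ofReal_exp,
      ← Complex.exp_sub, ← Complex.exp_add, ← Complex.exp_add]
    congr 1
    push_cast
    ring
  rw [charFun_apply_real, tiltedLaw, integral_map (by fun_prop) (by fun_prop), integral_tilted]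
  simp_rw [integrand_eq]
  rw [integral_const_mul, (h _ hst).2, ← Complex.exp_add]
  congr 1
  ring

variable [IsProbabilityMeasure ν]

lemma isProbabilityMeasure_tiltedLaw {s : ℝ} (hs : (s : ℂ) ∈ Metric.ball (0 : ℂ) R) (c m : ℝ) :
    IsProbabilityMeasure (tiltedLaw ν s c m) := by
  have := isProbabilityMeasure_tilted (h.integrable_exp hs)
  exact Measure.isProbabilityMeasure_map (by fun_prop)

lemma measureReal_Ioi_eq {s c : ℝ} (hs : (s : ℂ) ∈ Metric.ball (0 : ℂ) R) (hc : 0 < c) (m : ℝ) :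
    ν.real (Set.Ioi m) = Real.exp (V * (φ s).re - s * m) *
      ∫ w in Set.Ioi 0, Real.exp (-(s / c * w)) ∂tiltedLaw ν s c m := by
  have preimage_eq : (fun x => c * (x - m)) ⁻¹' Set.Ioi 0 = Set.Ioi m := by
    ext x
    simp [hc]
  have integrand_eq (x : ℝ) : Real.exp (V * (φ s).re - s * m) *
      ((Real.exp (s * x) / Real.exp (V * (φ s).re)) •
        Real.exp (-(s / c * (c * (x - m))))) = 1 := by
    rw [smul_eq_mul, ← Real.exp_sub, ← Real.exp_add, ← Real.exp_add, Real.exp_eq_one_iff]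
    field_simp
    ring
  rw [tiltedLaw, setIntegral_map measurableSet_Ioi (by fun_prop) (by fun_prop), preimage_eq,
    setIntegral_tilted, h.integral_exp hs, ← integral_const_mul]
  simp_rw [integrand_eq]
  simp

end HasCGFOnBall

lemma ofReal_mem_ball {s R : ℝ} (hs : |s| < R) : (s : ℂ) ∈ Metric.ball (0 : ℂ) R := by
  rwa [mem_ball_zero_iff, Complex.norm_real]

lemma norm_exp_add_sub_exp_le (a : ℝ) (e : ℂ) :
    ‖Complex.exp (a + e) - Complex.exp a‖ ≤ Real.exp a * (‖e‖ * Real.exp ‖e‖) := by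
  rw [Complex.exp_add, ← mul_sub_one, norm_mul, Complex.norm_exp, Complex.ofReal_re]
  gcongr
  simpa using Complex.norm_exp_sub_sum_le_norm_mul_exp e 1

namespace IsNormalizedCGF

variable {φ : ℂ → ℂ} {R A : ℝ} (h : IsNormalizedCGF φ R A)
include h

lemma norm_deriv_taylor_le {z s : ℂ} (hz : z ∈ Metric.ball (0 : ℂ) R)
    (hs : s ∈ Metric.ball (0 : ℂ) R) :
    ‖deriv φ z - deriv φ s - (z - s) * deriv (deriv φ) s‖ ≤ A * ‖z - s‖ ^ 2 := by
  have meanValue := Convex.norm_image_sub_le_of_norm_hasDerivWithin_le (𝕜 := ℂ)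
    (f := fun w => deriv φ w - w * deriv (deriv φ) s)
    (f' := fun w => deriv (deriv φ) w - 1 * deriv (deriv φ) s) (C := A * ‖z - s‖)
    (s := Metric.ball (0 : ℂ) R ∩ Metric.closedBall s ‖z - s‖) (x := s) (y := z)
    (fun w hw => ((h.hasDerivAt_deriv hw.1).sub
      ((hasDerivAt_id w).mul_const _)).hasDerivWithinAt)
    (fun w hw => by
      rw [one_mul]
      exact (h.lipschitz w hw.1 s hs).trans (mul_le_mul_of_nonneg_left
        (mem_closedBall_iff_norm.1 hw.2) h.lipschitzConst_nonneg))
    ((convex_ball _ _).inter (convex_closedBall _ _))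
    ⟨hs, Metric.mem_closedBall_self (norm_nonneg _)⟩ ⟨hz, mem_closedBall_iff_norm.2 le_rfl⟩
  convert meanValue using 1
  · congr 1
    ring
  · ring

lemma norm_taylor_le {z s : ℂ} (hz : z ∈ Metric.ball (0 : ℂ) R) (hs : s ∈ Metric.ball (0 : ℂ) R) :
    ‖φ z - φ s - (z - s) * deriv φ s - (z - s) ^ 2 / 2 * deriv (deriv φ) s‖ ≤ A * ‖z - s‖ ^ 3 := by
  have remainder_hasDerivAt {w : ℂ} (hw : w ∈ Metric.ball (0 : ℂ) R) : HasDerivAt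
      (fun w => φ w - (w - s) * deriv φ s - (w - s) ^ 2 / 2 * deriv (deriv φ) s)
      (deriv φ w - deriv φ s - (w - s) * deriv (deriv φ) s) w := by
    have linear : HasDerivAt (fun w => w - s) 1 w := (hasDerivAt_id w).sub_const s
    convert! ((h.hasDerivAt hw).sub (linear.mul_const (deriv φ s))).sub
      (((linear.pow 2).div_const 2).mul_const (deriv (deriv φ) s)) using 1
    simp
  have meanValue := Convex.norm_image_sub_le_of_norm_hasDerivWithin_le (C := A * ‖z - s‖ ^ 2)
    (s := Metric.ball (0 : ℂ) R ∩ Metric.closedBall s ‖z - s‖) (x := s) (y := z)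
    (fun w hw => (remainder_hasDerivAt hw.1).hasDerivWithinAt)
    (fun w hw => (h.norm_deriv_taylor_le hw.1 hs).trans (mul_le_mul_of_nonneg_left
      (pow_le_pow_left₀ (norm_nonneg _) (mem_closedBall_iff_norm.1 hw.2) 2)
      h.lipschitzConst_nonneg))
    ((convex_ball _ _).inter (convex_closedBall _ _))
    ⟨hs, Metric.mem_closedBall_self (norm_nonneg _)⟩ ⟨hz, mem_closedBall_iff_norm.2 le_rfl⟩
  convert meanValue using 1
  · congr 1
    ring
  · ring

lemma deriv_deriv_ofReal (s : ℝ) :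
    (((deriv (deriv φ) s).re : ℝ) : ℂ) = deriv (deriv φ) s := by
  have conj_eq := h.deriv_deriv_conj s
  rw [Complex.conj_ofReal] at conj_eq
  exact Complex.conj_eq_iff_re.1 conj_eq.symm

lemma half_le_re_deriv_deriv {z : ℂ} (hz : z ∈ Metric.ball (0 : ℂ) R) :
    1 / 2 ≤ (deriv (deriv φ) z).re := by
  have := (Complex.abs_re_le_norm _).trans (h.norm_deriv_deriv_sub_one_le_half hz)
  rw [Complex.sub_re, Complex.one_re] at this
  linarith [(abs_le.1 this).1]

variable {ν : Measure ℝ} {V s c y : ℝ} {v : NNReal}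

lemma exists_charFun_tiltedLaw_eq (hcgf : HasCGFOnBall ν V φ R) (hc : 0 < c) (hsc : |s| + c < R)
    (hsy : deriv φ s = y) (hv : (v : ℝ) = V * c ^ 2 * (deriv (deriv φ) s).re) {t : ℝ}
    (ht : |t| ≤ 1) :
    ∃ e : ℂ, ‖e‖ ≤ A * (c * |t|) ^ 3 ∧ charFun (tiltedLaw ν s c (y * V)) t
      = Complex.exp ((-(v * t ^ 2 / 2) : ℝ) + V * e) := by
  set ζ : ℂ := ((c * t : ℝ) : ℂ) * Complex.I with ζ_def
  have norm_ζ : ‖ζ‖ = c * |t| := by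
    rw [ζ_def, norm_mul, Complex.norm_I, mul_one, Complex.norm_real, norm_mul,
      Real.norm_of_nonneg hc.le, Real.norm_eq_abs]
  have hs := ofReal_mem_ball (lt_of_le_of_lt (le_add_of_nonneg_right hc.le) hsc)
  have hζ : (s : ℂ) + ζ ∈ Metric.ball (0 : ℂ) R := by
    rw [mem_ball_zero_iff]
    refine ((norm_add_le _ _).trans ?_).trans_lt hsc
    rw [norm_ζ, Complex.norm_real, Real.norm_eq_abs]
    gcongr
    exact mul_le_of_le_one_right hc.le ht
  refine ⟨φ (s + ζ) - φ s - ζ * y - ζ ^ 2 / 2 * deriv (deriv φ) s, ?_, ?_⟩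
  · simpa only [add_sub_cancel_left, hsy, norm_ζ] using h.norm_taylor_le hζ hs
  · rw [hcgf.charFun_tiltedLaw hs c _ _ hζ, ← h.deriv_deriv_ofReal, hv, ζ_def, mul_pow,
      Complex.I_sq]
    congr 1
    push_cast
    ring

lemma norm_charFun_tiltedLaw_sub_le (hcgf : HasCGFOnBall ν V φ R) (hV : 0 < V) (hc : 0 < c)
    (hsc : |s| + c < R) (hAc : A * c ≤ 1 / 8) (hsy : deriv φ s = y)
    (hv : (v : ℝ) = V * c ^ 2 * (deriv (deriv φ) s).re) {t : ℝ} (ht : |t| ≤ 1) :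
    ‖charFun (tiltedLaw ν s c (y * V)) t - charFun (gaussianReal 0 v) t‖
      ≤ |t| * (V * A * c ^ 3 * (t ^ 2 * Real.exp (-(2 * (V * c ^ 2 / 16)) * t ^ 2))) := by
  have hs := ofReal_mem_ball (lt_of_le_of_lt (le_add_of_nonneg_right hc.le) hsc)
  have hA := h.lipschitzConst_nonneg
  obtain ⟨e, he, charFun_eq⟩ := h.exists_charFun_tiltedLaw_eq hcgf hc hsc hsy hv ht
  have charFun_gaussian_eq :
      charFun (gaussianReal 0 v) t = Complex.exp ((-(v * t ^ 2 / 2) : ℝ) : ℂ) := by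
    rw [charFun_gaussianReal]
    push_cast
    ring_nf
  have gaussian_exponent_le : -(v * t ^ 2 / 2) ≤ -(V * c ^ 2 / 4) * t ^ 2 := by
    have : V * c ^ 2 * t ^ 2 * (1 / 2) ≤ V * c ^ 2 * t ^ 2 * (deriv (deriv φ) s).re := by
      gcongr
      exact h.half_le_re_deriv_deriv hs
    rw [hv]
    linarith
  have norm_Ve_le : ‖(V : ℂ) * e‖ ≤ V * (A * (c * |t|) ^ 3) := by
    rw [norm_mul, Complex.norm_real, Real.norm_of_nonneg hV.le]
    gcongr
  have cubic_le : V * (A * (c * |t|) ^ 3) ≤ V * c ^ 2 / 8 * t ^ 2 := by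
    calc V * (A * (c * |t|) ^ 3) = (V * c ^ 2 * |t| ^ 2) * ((A * c) * |t|) := by ring
      _ ≤ (V * c ^ 2 * |t| ^ 2) * (1 / 8 * 1) := by gcongr
      _ = _ := by rw [sq_abs]; ring
  rw [charFun_eq, charFun_gaussian_eq]
  calc _ ≤ Real.exp (-(V * c ^ 2 / 4) * t ^ 2) *
          (V * (A * (c * |t|) ^ 3) * Real.exp (V * c ^ 2 / 8 * t ^ 2)) := by
        refine (norm_exp_add_sub_exp_le _ _).trans ?_
        gcongr
        exact norm_Ve_le.trans cubic_le
    _ = V * (A * (c * |t|) ^ 3) * Real.exp (-(2 * (V * c ^ 2 / 16)) * t ^ 2) := by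
        rw [mul_left_comm, ← Real.exp_add]
        ring_nf
    _ = _ := by
        rw [mul_pow, pow_succ |t|, sq_abs]
        ring

end IsNormalizedCGF

lemma intervalIntegral_sq_mul_exp_neg_le {β a b : ℝ} (hβ : 0 < β) (hab : a ≤ b) :
    ∫ t in a..b, t ^ 2 * Real.exp (-(2 * β) * t ^ 2) ≤ β⁻¹ * √(Real.pi / β) := by
  have pointwise (t : ℝ) :
      t ^ 2 * Real.exp (-(2 * β) * t ^ 2) ≤ β⁻¹ * Real.exp (-β * t ^ 2) := by
    rw [le_inv_mul_iff₀ hβ]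
    calc β * (t ^ 2 * Real.exp (-(2 * β) * t ^ 2))
        = β * t ^ 2 * Real.exp (-(2 * β) * t ^ 2) := by ring
      _ ≤ Real.exp (β * t ^ 2) * Real.exp (-(2 * β) * t ^ 2) := by
        gcongr
        linarith [Real.add_one_le_exp (β * t ^ 2)]
      _ = Real.exp (-β * t ^ 2) := by
        rw [← Real.exp_add]
        ring_nf
  have hint : Integrable fun t : ℝ => β⁻¹ * Real.exp (-β * t ^ 2) :=
    (integrable_exp_neg_mul_sq hβ).const_mul _
  calc _ ≤ ∫ t in a..b, β⁻¹ * Real.exp (-β * t ^ 2) :=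
        intervalIntegral.integral_mono_on hab (Continuous.intervalIntegrable (by fun_prop) _ _)
          (Continuous.intervalIntegrable (by fun_prop) _ _) fun t _ => pointwise t
    _ ≤ ∫ t : ℝ, β⁻¹ * Real.exp (-β * t ^ 2) := by
        rw [intervalIntegral.integral_of_le hab]
        exact setIntegral_le_integral hint (ae_of_all _ fun t => by positivity)
    _ = _ := by rw [integral_const_mul, integral_gaussian]

/-! ### Cramér's expansion -/

lemma abs_sqrt_sub_one_le {q : ℝ} (hq : 0 ≤ q) : |√q - 1| ≤ |q - 1| := by
  have factor : q - 1 = (√q - 1) * (√q + 1) := by linear_combination -Real.sq_sqrt hq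
  rw [factor, abs_mul, abs_of_pos (by positivity : 0 < √q + 1)]
  exact le_mul_of_one_le_right (abs_nonneg _) (by linarith [Real.sqrt_nonneg q])

lemma intervalIntegral_charFun_bound_le {A c V : ℝ} (hA : 0 ≤ A) (hc : 0 < c) (hV : 0 < V) :
    ∫ t in (-1 : ℝ)..1,
        V * A * c ^ 3 * (t ^ 2 * Real.exp (-(2 * (V * c ^ 2 / 16)) * t ^ 2))
      ≤ 64 * A * √Real.pi / √V := by
  have sqrt_eq : √(Real.pi / (V * c ^ 2 / 16)) = 4 * √Real.pi / (c * √V) := by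
    rw [show Real.pi / (V * c ^ 2 / 16) = (4 / c) ^ 2 * (Real.pi / V) by field_simp; norm_num,
      Real.sqrt_mul (by positivity), Real.sqrt_sq (by positivity), Real.sqrt_div Real.pi_pos.le]
    field_simp
  rw [intervalIntegral.integral_const_mul]
  calc _ ≤ V * A * c ^ 3 * ((V * c ^ 2 / 16)⁻¹ * √(Real.pi / (V * c ^ 2 / 16))) := by
        gcongr
        exact intervalIntegral_sq_mul_exp_neg_le (by positivity) (by norm_num)
    _ = _ := by
        rw [sqrt_eq]
        field_simp
        ring

namespace IsNormalizedCGF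

variable {φ : ℂ → ℂ} {R A : ℝ} (h : IsNormalizedCGF φ R A) {s y : ℝ}
include h

lemma abs_re_deriv_deriv_sub_one_le (hsR : |s| < R) :
    |(deriv (deriv φ) s).re - 1| ≤ A * |s| := by
  have := h.norm_deriv_deriv_sub_one_le (ofReal_mem_ball hsR)
  rwa [← h.deriv_deriv_ofReal, Complex.norm_real, ← Complex.ofReal_one, ← Complex.ofReal_sub,
    Complex.norm_real] at this

lemma abs_saddle_sub_le (hsR : |s| < R) (hsy : deriv φ s = y) : |y - s| ≤ A * |s| ^ 2 := by
  have := h.norm_deriv_taylor_le (ofReal_mem_ball hsR) h.zero_mem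
  rwa [hsy, h.deriv_zero, h.deriv_deriv_zero, sub_zero, sub_zero, mul_one, ← Complex.ofReal_sub,
    Complex.norm_real, Complex.norm_real] at this

lemma abs_saddle_mul_sqrt_sub_le (hs0 : 0 ≤ s) (hsR : s < R) (hsy : deriv φ s = y) :
    |s * √(deriv (deriv φ) s).re - y| ≤ 2 * A * s ^ 2 := by
  have hs : |s| < R := by rwa [abs_of_nonneg hs0]
  have curvature := (abs_sqrt_sub_one_le
    (one_half_pos.le.trans (h.half_le_re_deriv_deriv (ofReal_mem_ball hs)))).trans
      (h.abs_re_deriv_deriv_sub_one_le hs)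
  have saddle := h.abs_saddle_sub_le hs hsy
  rw [abs_of_nonneg hs0] at curvature saddle
  rw [show s * √(deriv (deriv φ) s).re - y = s * (√(deriv (deriv φ) s).re - 1) - (y - s) by ring]
  calc _ ≤ |s * (√(deriv (deriv φ) s).re - 1)| + |y - s| := abs_sub _ _
    _ ≤ s * (A * s) + A * s ^ 2 := by
      rw [abs_mul, abs_of_nonneg hs0]
      gcongr
    _ = _ := by ring

lemma abs_mills_div_mills_sub_one_le {V : ℝ} (hV : 0 < V) (hs0 : 0 ≤ s) (hsy2 : s ≤ 2 * y)
    (hyR : y ≤ R / 8) (hsy : deriv φ s = y) :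
    |mills (s * √(V * (deriv (deriv φ) s).re)) / mills (y * √V) - 1| ≤ 16 * A * y := by
  have := h.radius_pos
  have hA := h.lipschitzConst_nonneg
  have hVsqrt : 0 < √V := Real.sqrt_pos.2 hV
  rcases (by linarith : 0 ≤ y).eq_or_lt with rfl | hy
  · rw [show s = 0 by linarith, zero_mul, zero_mul, div_self (mills_pos 0).ne']
    simp
  have hAy : 8 * A * y ≤ 1 / 2 := by
    linarith [mul_le_mul_of_nonneg_left hyR hA, h.mul_radius_le]
  have ratio_eq : s * √(V * (deriv (deriv φ) s).re) / (y * √V) - 1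
      = (s * √(deriv (deriv φ) s).re - y) / y := by
    rw [Real.sqrt_mul hV.le]
    field_simp
  have ratio_close : |s * √(V * (deriv (deriv φ) s).re) / (y * √V) - 1| ≤ 8 * A * y := by
    rw [ratio_eq, abs_div, abs_of_pos hy, div_le_iff₀ hy]
    calc _ ≤ 2 * A * s ^ 2 := h.abs_saddle_mul_sqrt_sub_le hs0 (by linarith) hsy
      _ ≤ 2 * A * (2 * y) ^ 2 := by gcongr
      _ = _ := by ring
  refine (abs_mills_div_sub_one_le (mul_pos hy hVsqrt) hAy ratio_close).trans_eq ?_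
  ring

variable {ν : Measure ℝ} [IsProbabilityMeasure ν] {V c : ℝ}

lemma abs_cdf_tiltedLaw_sub_cdf_gaussianReal_le {v : NNReal} (hcgf : HasCGFOnBall ν V φ R)
    (hV : 0 < V) (hc : 0 < c) (hsc : |s| + c < R) (hAc : A * c ≤ 1 / 8) (hsy : deriv φ s = y)
    (hv : (v : ℝ) = V * c ^ 2 * (deriv (deriv φ) s).re) (x : ℝ) :
    |cdf (tiltedLaw ν s c (y * V)) x - cdf (gaussianReal 0 v) x|
      ≤ 4 / (∫ s, fejer s) * (128 * A * √Real.pi + 256 / c) / √V := by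
  have hs := ofReal_mem_ball (lt_of_le_of_lt (le_add_of_nonneg_right hc.le) hsc)
  have hA := h.lipschitzConst_nonneg
  have := hcgf.isProbabilityMeasure_tiltedLaw hs c (y * V)
  have hhalf := h.half_le_re_deriv_deriv hs
  have hv_lower : (c * √V / 2) ^ 2 ≤ v := by
    rw [hv, div_pow, mul_pow, Real.sq_sqrt hV.le]
    nlinarith [mul_le_mul_of_nonneg_left hhalf (by positivity : 0 ≤ V * c ^ 2)]
  have hv0 : v ≠ 0 := NNReal.coe_ne_zero.1 ((by positivity : 0 < (c * √V / 2) ^ 2).trans_le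
    hv_lower).ne'
  have density_le : (√(v : ℝ))⁻¹ ≤ 2 / (c * √V) := by
    rw [← inv_div]
    exact inv_anti₀ (by positivity) (Real.le_sqrt_of_sq_le hv_lower)
  refine (esseen_smoothing_inequality _ _
    (G := fun t => V * A * c ^ 3 * (t ^ 2 * Real.exp (-(2 * (V * c ^ 2 / 16)) * t ^ 2)))
    (Continuous.intervalIntegrable (by fun_prop) _ _) (by positivity : 0 < 2 / (c * √V))
    (fun x y hxy => (cdf_gaussianReal_sub_le 0 hv0 hxy).trans
      (mul_le_mul_of_nonneg_right density_le (sub_nonneg.2 hxy)))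
    (fun t ht => h.norm_charFun_tiltedLaw_sub_le hcgf hV hc hsc hAc hsy hv (abs_le.2 ht))
    x).trans ?_
  have := integral_fejer_pos
  calc _ ≤ 4 / (∫ s, fejer s) * (2 * (64 * A * √Real.pi / √V) + 128 * (2 / (c * √V))) := by
        gcongr
        exact intervalIntegral_charFun_bound_le hA hc hV
    _ = _ := by
        field_simp
        ring

lemma abs_laplace_tiltedLaw_sub_mills_le (hcgf : HasCGFOnBall ν V φ R) (hV : 0 < V) (hc : 0 < c)
    (hs0 : 0 ≤ s) (hsc : s + c < R) (hAc : A * c ≤ 1 / 8) (hsy : deriv φ s = y) :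
    |(∫ w in Set.Ioi 0, Real.exp (-(s / c * w)) ∂tiltedLaw ν s c (y * V))
        - mills (s * √(V * (deriv (deriv φ) s).re))|
      ≤ 2 * (4 / (∫ s, fejer s) * (128 * A * √Real.pi + 256 / c) / √V) := by
  have hsc' : |s| + c < R := by rwa [abs_of_nonneg hs0]
  have hs := ofReal_mem_ball (lt_of_le_of_lt (le_add_of_nonneg_right hc.le) hsc')
  have hq : 0 < (deriv (deriv φ) s).re := one_half_pos.trans_le (h.half_le_re_deriv_deriv hs)
  lift V * c ^ 2 * (deriv (deriv φ) s).re to NNReal using (by positivity) with v hv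
  have hv0 : v ≠ 0 := by
    rw [← NNReal.coe_ne_zero, hv]
    positivity
  have sqrt_v : √(v : ℝ) = c * √(V * (deriv (deriv φ) s).re) := by
    rw [hv, mul_right_comm, mul_comm, Real.sqrt_mul (by positivity), Real.sqrt_sq hc.le]
  have := hcgf.isProbabilityMeasure_tiltedLaw hs c (y * V)
  have laplace_close := abs_setIntegral_exp_sub_le (tiltedLaw ν s c (y * V)) (gaussianReal 0 v)
    (div_nonneg hs0 hc.le)
    (h.abs_cdf_tiltedLaw_sub_cdf_gaussianReal_le hcgf hV hc hsc' hAc hsy hv)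
  rwa [setIntegral_exp_gaussianReal _ hv0, sqrt_v, ← mul_assoc, div_mul_cancel₀ _ hc.ne']
    at laplace_close

end IsNormalizedCGF

lemma one_sub_stdNormalCDF_mul_exp_eq {V s y r T : ℝ} (hV : 0 ≤ V)
    (hT : s * y - r = y ^ 2 / 2 - T) :
    (1 - stdNormalCDF (y * √V)) * Real.exp (V * T)
      = Real.exp (V * r - s * (y * V)) * mills (y * √V) := by
  rw [one_sub_stdNormalCDF, mul_right_comm, ← Real.exp_add, mul_pow, Real.sq_sqrt hV]
  congr 2
  linear_combination V * hT

lemma abs_div_mills_sub_one_le {L M C E y V : ℝ} (hV : 0 < V) (hy : 0 ≤ y) (hE : 0 ≤ E)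
    (hM : |M / mills (y * √V) - 1| ≤ E * y) (hLM : |L - M| ≤ C / √V) :
    |L / mills (y * √V) - 1| ≤ (E + C / mills 1) * (y + 1 / √V) := by
  have : 0 < √V := Real.sqrt_pos.2 hV
  have hm := mills_pos (y * √V)
  have hm1 := mills_pos 1
  have smoothing_error : |(L - M) / mills (y * √V)| ≤ C / mills 1 * (y + 1 / √V) := by
    rw [abs_div, abs_of_pos hm]
    calc |L - M| / mills (y * √V) ≤ (C / √V) / (mills 1 / (1 + y * √V)) := by
          gcongr
          · exact (abs_nonneg _).trans hLM
          · exact mills_one_div_one_add_le (by positivity)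
      _ = _ := by
          field_simp
          ring
  calc |L / mills (y * √V) - 1|
      = |(M / mills (y * √V) - 1) + (L - M) / mills (y * √V)| := by ring_nf
    _ ≤ E * y + C / mills 1 * (y + 1 / √V) :=
        (abs_add_le _ _).trans (add_le_add hM smoothing_error)
    _ ≤ E * (y + 1 / √V) + C / mills 1 * (y + 1 / √V) := by
        gcongr
        exact le_add_of_nonneg_right (by positivity)
    _ = _ := by ring

theorem exists_cramer_expansion (R A : ℝ) :
    ∃ D : ℝ, ∀ φ : ℂ → ℂ, IsNormalizedCGF φ R A →
      ∀ (ν : Measure ℝ) [IsProbabilityMeasure ν] (V : ℝ), 0 < V → HasCGFOnBall ν V φ R →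
      ∀ y : ℝ, 0 ≤ y → y < R / 8 →
        |ν.real (Set.Ioi (y * V)) / ((1 - stdNormalCDF (y * √V)) *
          Real.exp (V * (y ^ 3 * ∑' k, cramerCoeff φ k * y ^ k))) - 1| ≤ D * (y + 1 / √V) := by
  refine ⟨16 * A + 2 * (4 / (∫ s, fejer s) * (128 * A * √Real.pi + 256 / (R / 4))) / mills 1,
    fun φ h ν _ V hV hcgf y hy0 hyR => ?_⟩
  have hR := h.radius_pos
  have hA := h.lipschitzConst_nonneg
  obtain ⟨s, hs0, hsy2, hsy, hleg⟩ := h.exists_real_saddle hy0 (by linarith)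
  have hs := ofReal_mem_ball (by rw [abs_of_nonneg hs0]; linarith : |s| < R)
  have hc : 0 < R / 4 := by positivity
  have laplace := h.abs_laplace_tiltedLaw_sub_mills_le hcgf hV hc hs0 (by linarith)
    (by linarith [h.mul_radius_le]) hsy
  rw [one_sub_stdNormalCDF_mul_exp_eq hV.le hleg, hcgf.measureReal_Ioi_eq hs hc,
    mul_div_mul_left _ _ (Real.exp_pos _).ne']
  exact abs_div_mills_sub_one_le hV hy0 (by positivity)
    (h.abs_mills_div_mills_sub_one_le hV hs0 hsy2 hyR.le hsy) (laplace.trans_eq (by ring))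

/-! ### Cumulants -/

/-- The exponential generating series `∑ κ_k z^k / k!`, which is the cumulant generating function
of a law with cumulants `κ`. -/
def cumulantSeries (κ : ℕ → ℝ) (z : ℂ) : ℂ := ∑' k, ((κ k / k.factorial : ℝ) : ℂ) * z ^ k

lemma iteratedDeriv_zero_eq_of_hasSum {f : ℂ → ℂ} {p : ℕ → ℂ}
    (h : ∀ᶠ z in 𝓝 0, HasSum (fun n => p n * z ^ n) (f z)) (n : ℕ) :
    iteratedDeriv n f 0 = n.factorial * p n := by
  have power_series : HasFPowerSeriesAt f (FormalMultilinearSeries.ofScalars ℂ p) 0 := by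
    rw [hasFPowerSeriesAt_iff]
    filter_upwards [h] with z hz
    simpa [FormalMultilinearSeries.coeff_ofScalars, mul_comm] using hz
  have uniqueness :=
    power_series.analyticAt.hasFPowerSeriesAt.eq_formalMultilinearSeries power_series
  have coeff_eq := congrArg (fun q => FormalMultilinearSeries.coeff q n) uniqueness
  simp only [FormalMultilinearSeries.coeff_ofScalars] at coeff_eq
  rw [← coeff_eq, mul_div_cancel₀ _ (by exact_mod_cast n.factorial_ne_zero)]

lemma norm_iteratedDeriv_le_of_differentiableOn_ball {f : ℂ → ℂ} {c : ℂ} {r M : ℝ} {U : Set ℂ}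
    (hr : 0 < r) (hf : DifferentiableOn ℂ f U) (hU : Metric.closedBall c r ⊆ U)
    (hM : ∀ z ∈ U, ‖f z‖ ≤ M) (n : ℕ) :
    ‖iteratedDeriv n f c‖ ≤ n.factorial * M / r ^ n :=
  Complex.norm_iteratedDeriv_le_of_forall_mem_sphere_norm_le n hr
    (hf.mono (Metric.closure_ball_subset_closedBall.trans hU)).diffContOnCl
    fun z hz => hM z (hU (Metric.sphere_subset_closedBall hz))

lemma cumulantSeries_conj (κ : ℕ → ℝ) (z : ℂ) :
    cumulantSeries κ (starRingEnd ℂ z) = starRingEnd ℂ (cumulantSeries κ z) := by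
  simp only [cumulantSeries, Complex.conj_tsum, map_mul, map_pow, Complex.conj_ofReal]

section CumulantSeries

variable {κ : ℕ → ℝ} {A q : ℝ} (hq : 0 < q) (hκ : ∀ k, |κ k| / k.factorial ≤ A * q ^ k)
include hq hκ

lemma norm_cumulantSeries_term_le (k : ℕ) {z : ℂ} (hz : z ∈ Metric.ball (0 : ℂ) (1 / (2 * q))) :
    ‖((κ k / k.factorial : ℝ) : ℂ) * z ^ k‖ ≤ A * (1 / 2) ^ k := by
  have hz' : ‖z‖ ≤ 1 / (2 * q) := (mem_ball_zero_iff.1 hz).le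
  have hA : 0 ≤ A * q ^ k := le_trans (by positivity) (hκ k)
  rw [norm_mul, norm_pow, Complex.norm_real, Real.norm_eq_abs, abs_div, Nat.abs_cast]
  calc |κ k| / k.factorial * ‖z‖ ^ k ≤ A * q ^ k * (1 / (2 * q)) ^ k := by
        gcongr
        exact hκ k
    _ = A * (1 / 2) ^ k := by
        rw [mul_assoc, ← mul_pow]
        congr 2
        field_simp

lemma hasSum_cumulantSeries {z : ℂ} (hz : z ∈ Metric.ball (0 : ℂ) (1 / (2 * q))) :
    HasSum (fun k => ((κ k / k.factorial : ℝ) : ℂ) * z ^ k) (cumulantSeries κ z) :=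
  (Summable.of_norm_bounded (summable_geometric_two.mul_left A)
    fun k => norm_cumulantSeries_term_le hq hκ k hz).hasSum

lemma differentiableOn_cumulantSeries :
    DifferentiableOn ℂ (cumulantSeries κ) (Metric.ball 0 (1 / (2 * q))) :=
  Complex.differentiableOn_tsum_of_summable_norm (summable_geometric_two.mul_left A)
    (fun k => by fun_prop) Metric.isOpen_ball fun k _ => norm_cumulantSeries_term_le hq hκ k

lemma norm_cumulantSeries_le {z : ℂ} (hz : z ∈ Metric.ball (0 : ℂ) (1 / (2 * q))) :
    ‖cumulantSeries κ z‖ ≤ A * 2 :=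
  tsum_of_norm_bounded (hasSum_geometric_two.mul_left A)
    fun k => norm_cumulantSeries_term_le hq hκ k hz

lemma iteratedDeriv_cumulantSeries_zero (n : ℕ) :
    iteratedDeriv n (cumulantSeries κ) 0 = κ n := by
  have hsum : ∀ᶠ z in 𝓝 (0 : ℂ), HasSum (fun k => ((κ k / k.factorial : ℝ) : ℂ) * z ^ k)
      (cumulantSeries κ z) := by
    filter_upwards [Metric.ball_mem_nhds (0 : ℂ) (by positivity : 0 < 1 / (2 * q))] with z hz
    exact hasSum_cumulantSeries hq hκ hz
  rw [iteratedDeriv_zero_eq_of_hasSum hsum, Complex.ofReal_div, Complex.ofReal_natCast,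
    mul_div_cancel₀ _ (by exact_mod_cast n.factorial_ne_zero)]

lemma norm_deriv_deriv_deriv_cumulantSeries_le {z : ℂ}
    (hz : z ∈ Metric.ball (0 : ℂ) (1 / (4 * q))) :
    ‖deriv (deriv (deriv (cumulantSeries κ))) z‖ ≤ 768 * A * q ^ 3 := by
  have hball : Metric.closedBall z (1 / (4 * q)) ⊆ Metric.ball 0 (1 / (2 * q)) := by
    refine Metric.closedBall_subset_ball' ?_
    rw [show 1 / (2 * q) = 1 / (4 * q) + 1 / (4 * q) by field_simp; norm_num]
    gcongr
    exact hz
  have cauchy := norm_iteratedDeriv_le_of_differentiableOn_ball (by positivity)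
    (differentiableOn_cumulantSeries hq hκ) hball
    (fun w hw => norm_cumulantSeries_le hq hκ hw) 3
  rw [iteratedDeriv_succ, iteratedDeriv_succ, iteratedDeriv_one] at cauchy
  refine cauchy.trans_eq ?_
  rw [Nat.factorial_succ, Nat.factorial_two, one_div, inv_pow, div_inv_eq_mul]
  push_cast
  ring

lemma isNormalizedCGF_cumulantSeries (h0 : κ 0 = 0) (h1 : κ 1 = 0) (h2 : κ 2 = 1) :
    IsNormalizedCGF (cumulantSeries κ) (1 / (1536 * A * q ^ 3)) (768 * A * q ^ 3) := by
  have hAq : 1 / 2 ≤ A * q ^ 2 := by simpa [h2] using hκ 2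
  have hA : 0 < A := pos_of_mul_pos_left (by linarith) (sq_nonneg q)
  have radius_le : 1 / (1536 * A * q ^ 3) ≤ 1 / (4 * q) := by
    gcongr 1 / ?_
    nlinarith
  have hsub := Metric.ball_subset_ball (x := (0 : ℂ)) radius_le
  have hdiff := differentiableOn_cumulantSeries hq hκ
  have hsub' : Metric.ball (0 : ℂ) (1 / (4 * q)) ⊆ Metric.ball 0 (1 / (2 * q)) :=
    Metric.ball_subset_ball (by gcongr; norm_num)
  have hdiff'' := (hdiff.deriv Metric.isOpen_ball).deriv Metric.isOpen_ball
  have hderiv := iteratedDeriv_cumulantSeries_zero hq hκ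
  refine ⟨by positivity, ?_, hdiff.mono (hsub.trans hsub'), ?_, ?_, ?_, fun z hz w hw => ?_,
    cumulantSeries_conj κ⟩
  · field_simp
    norm_num
  · simpa [h0] using hderiv 0
  · simpa [h1] using hderiv 1
  · simpa [iteratedDeriv_succ, h2] using hderiv 2
  · exact (convex_ball _ _).norm_image_sub_le_of_norm_deriv_le (𝕜 := ℂ)
      (fun x hx => hdiff''.differentiableAt (Metric.isOpen_ball.mem_nhds (hsub' hx)))
      (fun x hx => norm_deriv_deriv_deriv_cumulantSeries_le hq hκ hx) (hsub hw) (hsub hz)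

end CumulantSeries

lemma iteratedDeriv_comp_mul_left (f : ℝ → ℝ) (b : ℝ) (k : ℕ) :
    iteratedDeriv k (fun t => f (b * t)) = fun t => b ^ k * iteratedDeriv k f (b * t) := by
  induction k with
  | zero => simp
  | succ k ih =>
    ext t
    rw [iteratedDeriv_succ, ih, deriv_const_mul_field,
      deriv_comp_mul_left b (iteratedDeriv k f) t, ← iteratedDeriv_succ, smul_eq_mul]
    ring

section Cumulant

variable {Ω : Type*} [MeasurableSpace Ω] (X : Ω → ℝ) (μ : Measure Ω)

lemma cgf_const_mul (b t : ℝ) : cgf (fun ω => b * X ω) μ t = cgf X μ (b * t) := by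
  simp only [cgf, mgf, mul_left_comm t b, mul_assoc]

lemma cumulant_const_mul (b : ℝ) (k : ℕ) :
    cumulant (fun ω => b * X ω) μ k = b ^ k * cumulant X μ k := by
  rw [cumulant, funext (cgf_const_mul X μ b), iteratedDeriv_comp_mul_left, cumulant]
  simp only [mul_zero]

lemma cumulant_zero [IsProbabilityMeasure μ] : cumulant X μ 0 = 0 := by
  simp [cumulant]

end Cumulant

namespace CramerCondition

variable {Ω : Type*} [MeasurableSpace Ω] {μ : Measure Ω} {X : Ω → ℝ} {H C : ℝ}
  (h : CramerCondition X μ H C)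
include h

lemma integrable_exp_mul {t : ℝ} (ht : |t| < H) : Integrable (fun ω => Real.exp (t * X ω)) μ :=
  (h.integrable t (ofReal_mem_ball ht)).norm.congr
    (ae_of_all _ fun ω => by simp [Complex.norm_exp])

lemma mem_interior_integrableExpSet {t : ℝ} (ht : |t| < H) :
    t ∈ interior (integrableExpSet X μ) :=
  mem_interior.2 ⟨Set.Ioo (-H) H, fun _ hs => h.integrable_exp_mul (abs_lt.2 hs), isOpen_Ioo,
    abs_lt.1 ht⟩

lemma analyticOnNhd_complexMGF : AnalyticOnNhd ℂ (complexMGF X μ) (Metric.ball (0 : ℂ) H) :=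
  fun w hw => analyticAt_complexMGF (h.mem_interior_integrableExpSet
    ((Complex.abs_re_le_norm w).trans_lt (mem_ball_zero_iff.1 hw)))

/- The principal logarithm inverts `exp` away from `0` only: the identity holds near `0`, where the
moment generating function does not vanish, and extends to the disc by analyticity. -/
lemma complexMGF_eq_exp [IsProbabilityMeasure μ] {z : ℂ} (hz : z ∈ Metric.ball (0 : ℂ) H) :
    complexMGF X μ z = Complex.exp (complexCGF X μ z) := by
  have h0 : (0 : ℂ) ∈ Metric.ball (0 : ℂ) H := Metric.mem_ball_self (Metric.pos_of_mem_ball hz)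
  have hmgf := h.analyticOnNhd_complexMGF
  have mgf_ne_zero : ∀ᶠ w in 𝓝 0, complexMGF X μ w ≠ 0 :=
    (hmgf 0 h0).continuousAt.eventually_ne (by simp [complexMGF])
  refine hmgf.eqOn_of_preconnected_of_eventuallyEq h.analytic.cexp
    (convex_ball _ _).isPreconnected h0 ?_ hz
  filter_upwards [mgf_ne_zero] with w hw
  exact (Complex.exp_log hw).symm

lemma iteratedDeriv_complexCGF_ofReal (k : ℕ) {x : ℝ} (hx : |x| < H) :
    iteratedDeriv k (complexCGF X μ) x = (iteratedDeriv k (cgf X μ) x : ℝ) := by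
  induction k generalizing x with
  | zero =>
    rw [iteratedDeriv_zero, iteratedDeriv_zero, complexCGF, complexMGF_ofReal, cgf,
      Complex.ofReal_log mgf_nonneg]
  | succ k ih =>
    have hnhds : ∀ᶠ y : ℝ in 𝓝 x, |y| < H := (continuous_abs.tendsto x).eventually_lt_const hx
    have complex_deriv : HasDerivAt (iteratedDeriv k (complexCGF X μ))
        (iteratedDeriv (k + 1) (complexCGF X μ) x) (x : ℂ) := by
      rw [iteratedDeriv_succ, iteratedDeriv_eq_iterate]
      exact ((h.analytic _ (ofReal_mem_ball hx)).iterated_deriv k).differentiableAt.hasDerivAt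
    have cast_deriv : HasDerivAt (fun y : ℝ => ((iteratedDeriv k (cgf X μ) y : ℝ) : ℂ))
        (iteratedDeriv (k + 1) (complexCGF X μ) x) x := by
      refine complex_deriv.comp_ofReal.congr_of_eventuallyEq ?_
      filter_upwards [hnhds] with y hy using (ih hy).symm
    have real_deriv : HasDerivAt (iteratedDeriv k (cgf X μ))
        (iteratedDeriv (k + 1) (complexCGF X μ) x).re x :=
      Complex.reCLM.hasFDerivAt.comp_hasDerivAt x cast_deriv
    rw [cast_deriv.unique real_deriv.ofReal_comp, iteratedDeriv_succ (f := cgf X μ),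
      real_deriv.deriv]

section

variable (hH : 0 < H)
include hH

lemma iteratedDeriv_complexCGF_zero (k : ℕ) :
    iteratedDeriv k (complexCGF X μ) 0 = (cumulant X μ k : ℝ) := by
  simpa [cumulant] using h.iteratedDeriv_complexCGF_ofReal k (x := 0) (by simpa using hH)

lemma abs_cumulant_le (k : ℕ) : |cumulant X μ k| / k.factorial ≤ C * (2 / H) ^ k := by
  have cauchy := norm_iteratedDeriv_le_of_differentiableOn_ball (by positivity : 0 < H / 2)
    h.analytic.differentiableOn (Metric.closedBall_subset_ball (by linarith))
    (fun w hw => (h.bound w hw).le) k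
  rw [h.iteratedDeriv_complexCGF_zero hH, Complex.norm_real, Real.norm_eq_abs] at cauchy
  rw [div_le_iff₀ (by positivity)]
  refine cauchy.trans_eq ?_
  rw [div_pow, div_pow]
  field_simp

lemma cumulant_one [IsProbabilityMeasure μ] (hmean : ∫ ω, X ω ∂μ = 0) : cumulant X μ 1 = 0 := by
  rw [cumulant, iteratedDeriv_one,
    deriv_cgf_zero (h.mem_interior_integrableExpSet (by simpa using hH)), hmean, zero_div]

lemma cumulant_two [IsProbabilityMeasure μ] (hX : AEMeasurable X μ) (hmean : ∫ ω, X ω ∂μ = 0) :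
    cumulant X μ 2 = variance X μ := by
  have h0 : (0 : ℝ) ∈ interior (integrableExpSet X μ) :=
    h.mem_interior_integrableExpSet (by simpa using hH)
  rw [cumulant, iteratedDeriv_two_cgf h0, deriv_cgf_zero h0, variance_of_integral_eq_zero hX hmean]
  simp [hmean]

end

lemma hasSum_complexCGF {z : ℂ} (hz : z ∈ Metric.ball (0 : ℂ) H) :
    HasSum (fun k => ((cumulant X μ k / k.factorial : ℝ) : ℂ) * z ^ k) (complexCGF X μ z) := by
  convert! Complex.hasSum_taylorSeries_on_ball h.analytic.differentiableOn hz using 2 with k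
  rw [h.iteratedDeriv_complexCGF_zero (Metric.pos_of_mem_ball hz), sub_zero, smul_eq_mul,
    smul_eq_mul]
  push_cast
  ring

end CramerCondition

/-! ### Moment generating functions of limits in `L²` -/

lemma norm_cexp_sub_cexp_le (a b : ℂ) :
    ‖Complex.exp a - Complex.exp b‖ ≤ (Real.exp a.re + Real.exp b.re) * ‖a - b‖ := by
  have mean_value : ‖Complex.exp a - Complex.exp b‖ ≤ Real.exp (max a.re b.re) * ‖a - b‖ :=
    Convex.norm_image_sub_le_of_norm_deriv_le (𝕜 := ℂ) (s := {w : ℂ | w.re ≤ max a.re b.re})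
      (fun w _ => Complex.differentiableAt_exp)
      (fun w hw => by
        rw [Complex.deriv_exp, Complex.norm_exp]
        exact Real.exp_le_exp.2 hw)
      (convex_halfSpace_re_le _) (le_max_right a.re b.re) (le_max_left a.re b.re)
  refine mean_value.trans (mul_le_mul_of_nonneg_right ?_ (norm_nonneg _))
  rw [Real.exp_monotone.map_max]
  exact max_le_add_of_nonneg (Real.exp_pos _).le (Real.exp_pos _).le

section MGFLimit

variable {Ω : Type*} [MeasurableSpace Ω] {μ : Measure Ω}

lemma aestronglyMeasurable_exp_const_mul {f : Ω → ℝ} (hf : AEStronglyMeasurable f μ) (τ : ℝ) :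
    AEStronglyMeasurable (fun ω => Real.exp (τ * f ω)) μ :=
  (by fun_prop : Continuous fun x : ℝ => Real.exp (τ * x)).comp_aestronglyMeasurable hf

lemma integrable_exp_mul_of_eLpNorm_le [IsFiniteMeasure μ] {f : Ω → ℝ} {τ : ℝ} {K : ENNReal}
    (hf : AEStronglyMeasurable f μ) (hK : K ≠ ⊤)
    (hfK : eLpNorm (fun ω => Real.exp (τ * f ω)) 2 μ ≤ K) :
    Integrable (fun ω => Real.exp (τ * f ω)) μ :=
  MemLp.integrable one_le_two
    ⟨aestronglyMeasurable_exp_const_mul hf τ, hfK.trans_lt hK.lt_top⟩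

lemma eLpNorm_exp_two_eq {f : Ω → ℝ} {τ : ℝ}
    (hf : Integrable (fun ω => Real.exp (2 * τ * f ω)) μ) :
    eLpNorm (fun ω => Real.exp (τ * f ω)) 2 μ = ENNReal.ofReal (√(mgf f μ (2 * τ))) := by
  have enorm_exp_sq : ∀ ω,
      ‖Real.exp (τ * f ω)‖ₑ ^ (2 : ℝ) = ENNReal.ofReal (Real.exp (2 * τ * f ω)) := fun ω => by
    rw [Real.enorm_of_nonneg (Real.exp_pos _).le,
      ENNReal.ofReal_rpow_of_pos (Real.exp_pos _), ← Real.exp_mul]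
    ring_nf
  simp only [eLpNorm_eq_lintegral_rpow_enorm_toReal two_ne_zero ENNReal.ofNat_ne_top,
    ENNReal.toReal_ofNat, enorm_exp_sq]
  rw [← ofReal_integral_eq_lintegral_ofReal hf (ae_of_all _ fun _ => (Real.exp_pos _).le),
    ← mgf, Real.sqrt_eq_rpow, ENNReal.ofReal_rpow_of_nonneg mgf_nonneg (by norm_num)]

lemma eLpNorm_one_cexp_sub_cexp_le {f g : Ω → ℝ} {z : ℂ} {K : ENNReal}
    (hf : AEStronglyMeasurable f μ) (hg : AEStronglyMeasurable g μ)
    (hfK : eLpNorm (fun ω => Real.exp (z.re * f ω)) 2 μ ≤ K)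
    (hgK : eLpNorm (fun ω => Real.exp (z.re * g ω)) 2 μ ≤ K) :
    eLpNorm (fun ω => Complex.exp (z * f ω) - Complex.exp (z * g ω)) 1 μ
      ≤ ‖z‖ₑ * (K + K) * eLpNorm (f - g) 2 μ := by
  have hfm := aestronglyMeasurable_exp_const_mul hf z.re
  have hgm := aestronglyMeasurable_exp_const_mul hg z.re
  set w : Ω → ℝ := ‖z‖ • ((fun ω => Real.exp (z.re * f ω)) + fun ω => Real.exp (z.re * g ω))
    with hw
  have pointwise : ∀ ω, ‖Complex.exp (z * f ω) - Complex.exp (z * g ω)‖ ≤ ‖(w • (f - g)) ω‖ := by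
    intro ω
    have hw_nonneg : 0 ≤ w ω := by
      simp only [hw, Pi.smul_apply, Pi.add_apply, smul_eq_mul]
      positivity
    refine (norm_cexp_sub_cexp_le _ _).trans_eq ?_
    rw [Pi.smul_apply', smul_eq_mul, norm_mul, Real.norm_of_nonneg hw_nonneg, ← mul_sub,
      ← Complex.ofReal_sub, norm_mul, Complex.norm_real, Pi.sub_apply]
    simp only [hw, Pi.smul_apply, Pi.add_apply, smul_eq_mul, Complex.re_mul_ofReal]
    ring
  calc _ ≤ eLpNorm (w • (f - g)) 1 μ := eLpNorm_mono pointwise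
    _ ≤ eLpNorm w 2 μ * eLpNorm (f - g) 2 μ :=
        eLpNorm_smul_le_mul_eLpNorm (hf.sub hg) ((hfm.add hgm).const_smul _)
    _ ≤ ‖z‖ₑ * (K + K) * eLpNorm (f - g) 2 μ := by
        rw [hw, eLpNorm_const_smul, enorm_norm]
        gcongr
        exact (eLpNorm_add_le hfm hgm one_le_two).trans (add_le_add hfK hgK)

variable {ι : Type*} {l : Filter ι} [l.NeBot] [l.IsCountablyGenerated] {f : ι → Ω → ℝ} {S : Ω → ℝ}

lemma eLpNorm_exp_le_of_tendsto_eLpNorm (hf : ∀ i, AEStronglyMeasurable (f i) μ)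
    (hS : AEStronglyMeasurable S μ) (hfS : Tendsto (fun i => eLpNorm (f i - S) 2 μ) l (𝓝 0))
    {τ : ℝ} {K : ENNReal} (hfK : ∀ i, eLpNorm (fun ω => Real.exp (τ * f i ω)) 2 μ ≤ K) :
    eLpNorm (fun ω => Real.exp (τ * S ω)) 2 μ ≤ K := by
  obtain ⟨ns, -, hns⟩ :=
    (tendstoInMeasure_of_tendsto_eLpNorm two_ne_zero hf hS hfS).exists_seq_tendsto_ae'
  refine Lp.eLpNorm_le_of_ae_tendsto (u := atTop) (Eventually.of_forall fun n => hfK (ns n))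
    (fun n => aestronglyMeasurable_exp_const_mul (hf (ns n)) τ) ?_
  filter_upwards [hns] with ω hω
  exact (Real.continuous_exp.tendsto _).comp (hω.const_mul τ)

lemma tendsto_complexMGF_of_tendsto_eLpNorm [IsFiniteMeasure μ]
    (hf : ∀ i, AEStronglyMeasurable (f i) μ) (hS : AEStronglyMeasurable S μ)
    (hfS : Tendsto (fun i => eLpNorm (f i - S) 2 μ) l (𝓝 0)) {z : ℂ} {K : ENNReal} (hK : K ≠ ⊤)
    (hfK : ∀ i, eLpNorm (fun ω => Real.exp (z.re * f i ω)) 2 μ ≤ K) :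
    Tendsto (fun i => complexMGF (f i) μ z) l (𝓝 (complexMGF S μ z)) := by
  have hSK := eLpNorm_exp_le_of_tendsto_eLpNorm hf hS hfS hfK
  have integrable_cexp : ∀ {g : Ω → ℝ}, AEStronglyMeasurable g μ →
      eLpNorm (fun ω => Real.exp (z.re * g ω)) 2 μ ≤ K →
      Integrable (fun ω => Complex.exp (z * g ω)) μ := fun hg hgK =>
    integrable_cexp_mul_of_re_mem_integrableExpSet hg.aemeasurable
      (integrable_exp_mul_of_eLpNorm_le hg hK hgK)
  have dist_tendsto : Tendsto (fun i => ‖z‖ₑ * (K + K) * eLpNorm (f i - S) 2 μ) l (𝓝 0) := by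
    simpa using ENNReal.Tendsto.const_mul hfS
      (Or.inr (ENNReal.mul_ne_top enorm_ne_top (ENNReal.add_ne_top.2 ⟨hK, hK⟩)))
  rw [tendsto_iff_edist_tendsto_0]
  refine tendsto_of_tendsto_of_tendsto_of_le_of_le tendsto_const_nhds dist_tendsto
    (fun _ => zero_le) fun i => ?_
  rw [edist_eq_enorm_sub, complexMGF, complexMGF,
    ← integral_sub (integrable_cexp (hf i) (hfK i)) (integrable_cexp hS hSK)]
  refine (enorm_integral_le_lintegral_enorm _).trans ?_
  rw [← eLpNorm_one_eq_lintegral_enorm]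
  exact eLpNorm_one_cexp_sub_cexp_le (hf i) hS (hfK i) hSK

end MGFLimit

/-! ### Sums of independent variables under Cramér's condition -/

namespace CramerCondition

variable {Ω : Type*} [MeasurableSpace Ω] {μ : Measure Ω} {X : Ω → ℝ} {H C : ℝ}

lemma bound_pos (h : CramerCondition X μ H C) (hH : 0 < H) : 0 < C :=
  (norm_nonneg _).trans_lt (h.bound 0 (Metric.mem_ball_self hH))

variable [IsProbabilityMeasure μ] (h : CramerCondition X μ H C) (hH : 0 < H)
  (hmean : ∫ ω, X ω ∂μ = 0)
include h hH hmean

lemma norm_cumulant_term_le {w : ℂ} (hw : ‖w‖ ≤ H / 4) (k : ℕ) :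
    ‖((cumulant X μ k / k.factorial : ℝ) : ℂ) * w ^ k‖
      ≤ 16 * C / H ^ 2 * ‖w‖ ^ 2 * (1 / 2) ^ k := by
  have hC := h.bound_pos hH
  rw [norm_mul, norm_pow, Complex.norm_real, Real.norm_eq_abs, abs_div, Nat.abs_cast]
  match k with
  | 0 =>
    rw [cumulant_zero, abs_zero, zero_div, zero_mul]
    positivity
  | 1 =>
    rw [h.cumulant_one hH hmean, abs_zero, zero_div, zero_mul]
    positivity
  | k + 2 =>
    calc |cumulant X μ (k + 2)| / (k + 2).factorial * ‖w‖ ^ (k + 2)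
        ≤ C * (2 / H) ^ (k + 2) * (‖w‖ ^ 2 * (H / 4) ^ k) := by
          rw [pow_add ‖w‖, mul_comm (‖w‖ ^ k)]
          gcongr
          exact h.abs_cumulant_le hH _
      _ = C * (2 / H) ^ 2 * ‖w‖ ^ 2 * ((2 / H) * (H / 4)) ^ k := by rw [mul_pow]; ring
      _ = C * (2 / H) ^ 2 * ‖w‖ ^ 2 * (1 / 2) ^ k := by
          congr 2; field_simp; norm_num
      _ = _ := by rw [pow_add (1 / 2 : ℝ)]; field_simp; ring

lemma norm_complexCGF_le {w : ℂ} (hw : ‖w‖ ≤ H / 4) :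
    ‖complexCGF X μ w‖ ≤ 32 * C / H ^ 2 * ‖w‖ ^ 2 := by
  have taylor := h.hasSum_complexCGF (z := w) (by rw [mem_ball_zero_iff]; linarith)
  have geometric := hasSum_geometric_two.mul_left (16 * C / H ^ 2 * ‖w‖ ^ 2)
  rw [← taylor.tsum_eq]
  exact (tsum_of_norm_bounded geometric (h.norm_cumulant_term_le hH hmean hw)).trans_eq (by ring)

lemma mgf_le {t : ℝ} (ht : |t| ≤ H / 4) : mgf X μ t ≤ Real.exp (32 * C / H ^ 2 * t ^ 2) := by
  have ht_norm : ‖(t : ℂ)‖ = |t| := Complex.norm_real t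
  calc mgf X μ t = Real.exp (complexCGF X μ t).re := by
        rw [← Complex.norm_exp, ← h.complexMGF_eq_exp (ofReal_mem_ball (by linarith)),
          complexMGF_ofReal, Complex.norm_real, Real.norm_of_nonneg mgf_nonneg]
    _ ≤ Real.exp (32 * C / H ^ 2 * t ^ 2) := by
        rw [Real.exp_le_exp, ← sq_abs t, ← ht_norm]
        exact (Complex.re_le_norm _).trans (h.norm_complexCGF_le hH hmean (ht_norm.trans_le ht))

end CramerCondition

lemma abs_re_mul_ofReal_le (z : ℂ) (b : ℝ) : |z.re * b| ≤ ‖z * b‖ := by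
  rw [← Complex.re_mul_ofReal]
  exact Complex.abs_re_le_norm _

section ComplexMGF

variable {Ω ι : Type*} [MeasurableSpace Ω] {μ : Measure Ω}

lemma complexMGF_const_smul (X : Ω → ℝ) (b : ℝ) (z : ℂ) :
    complexMGF (b • X) μ z = complexMGF X μ (z * b) := by
  simp only [complexMGF, Pi.smul_apply, smul_eq_mul, Complex.ofReal_mul, mul_assoc]

lemma complexMGF_finset_sum {X : ι → Ω → ℝ} (hX : iIndepFun X μ) (hmeas : ∀ i, Measurable (X i))
    (F : Finset ι) (z : ℂ) : complexMGF (∑ i ∈ F, X i) μ z = ∏ i ∈ F, complexMGF (X i) μ z := by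
  have indep_subtype : iIndepFun (fun i : F => X i) μ := hX.precomp Subtype.val_injective
  have integral_prod := indep_subtype.integral_fun_prod_comp (𝕜 := ℂ)
    (f := fun _ (x : ℝ) => Complex.exp (z * x)) (fun i => (hmeas i).aemeasurable)
    (fun i => Continuous.aestronglyMeasurable (by fun_prop))
  rw [← Finset.prod_coe_sort F]
  refine Eq.trans ?_ integral_prod
  rw [complexMGF]
  congr 1 with ω
  rw [Finset.prod_coe_sort F fun i => Complex.exp (z * (X i ω : ℂ)), ← Complex.exp_sum,
    ← Finset.mul_sum, Finset.sum_apply, Complex.ofReal_sum]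

end ComplexMGF

/-- A family of independent centred random variables that satisfy Cramér's condition with common
constants: the noise of the model. -/
structure IsCramerFamily {Ω ι : Type*} [MeasurableSpace Ω] (ε : ι → Ω → ℝ) (μ : Measure Ω)
    (H C : ℝ) : Prop where
  measurable : ∀ i, Measurable (ε i)
  indep : iIndepFun ε μ
  integral_eq_zero : ∀ i, ∫ ω, ε i ω ∂μ = 0
  radius_pos : 0 < H
  cramer : ∀ i, CramerCondition (ε i) μ H C

namespace IsCramerFamily

variable {Ω ι : Type*} [MeasurableSpace Ω] {μ : Measure Ω} {ε : ι → Ω → ℝ} {H C : ℝ}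
  (h : IsCramerFamily ε μ H C) {b : ι → ℝ}
include h

lemma indep_smul (b : ι → ℝ) : iIndepFun (fun i => b i • ε i) μ :=
  h.indep.comp (fun i x => b i * x) fun i => by fun_prop

lemma aestronglyMeasurable_sum_smul (F : Finset ι) : AEStronglyMeasurable (∑ i ∈ F, b i • ε i) μ :=
  F.aestronglyMeasurable_sum fun i _ => ((h.measurable i).const_smul (b i)).aestronglyMeasurable

variable [IsProbabilityMeasure μ]

lemma complexMGF_sum_smul (F : Finset ι) {z : ℂ} (hz : ∀ i, ‖z * b i‖ < H) :
    complexMGF (∑ i ∈ F, b i • ε i) μ z = Complex.exp (∑ i ∈ F, complexCGF (ε i) μ (z * b i)) := by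
  rw [complexMGF_finset_sum (h.indep_smul b) (fun i => (h.measurable i).const_smul _),
    Complex.exp_sum]
  refine Finset.prod_congr rfl fun i _ => ?_
  rw [complexMGF_const_smul, (h.cramer i).complexMGF_eq_exp (mem_ball_zero_iff.2 (hz i))]

lemma integrable_exp_mul_sum_smul (F : Finset ι) {t : ℝ} (ht : ∀ i, |t * b i| < H) :
    Integrable (fun ω => Real.exp (t * (∑ i ∈ F, b i • ε i) ω)) μ :=
  (h.indep_smul b).integrable_exp_mul_sum (fun i => (h.measurable i).const_smul _) fun i _ => by
    simpa only [mul_assoc, Pi.smul_apply, smul_eq_mul] using (h.cramer i).integrable_exp_mul (ht i)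

lemma mgf_sum_smul_le (hb : Summable fun i => b i ^ 2) (F : Finset ι) {t : ℝ}
    (ht : ∀ i, |t * b i| ≤ H / 4) :
    mgf (∑ i ∈ F, b i • ε i) μ t ≤ Real.exp (32 * C / H ^ 2 * (t ^ 2 * ∑' i, b i ^ 2)) := by
  have hH := h.radius_pos
  calc mgf (∑ i ∈ F, b i • ε i) μ t
      = ∏ i ∈ F, mgf (ε i) μ (b i * t) := by
        rw [(h.indep_smul b).mgf_sum fun i => (h.measurable i).const_smul _]
        simp only [mgf_smul_left]
    _ ≤ ∏ i ∈ F, Real.exp (32 * C / H ^ 2 * (t * b i) ^ 2) :=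
        Finset.prod_le_prod (fun _ _ => mgf_nonneg) fun i _ => by
          rw [mul_comm (b i)]
          exact (h.cramer i).mgf_le hH (h.integral_eq_zero i) (ht i)
    _ = Real.exp (32 * C / H ^ 2 * (t ^ 2 * ∑ i ∈ F, b i ^ 2)) := by
        simp only [← Real.exp_sum, mul_pow, Finset.mul_sum]
    _ ≤ Real.exp (32 * C / H ^ 2 * (t ^ 2 * ∑' i, b i ^ 2)) := by
        rw [Real.exp_le_exp]
        rcases isEmpty_or_nonempty ι with _ | ⟨⟨i⟩⟩
        · rw [Finset.eq_empty_of_isEmpty F, Finset.sum_empty, tsum_empty]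
        · have hC := (h.cramer i).bound_pos hH
          gcongr
          exact hb.sum_le_tsum _ fun i _ => sq_nonneg _

lemma eLpNorm_exp_sum_smul_le (hb : Summable fun i => b i ^ 2) (F : Finset ι) {t : ℝ}
    (ht : ∀ i, |t * b i| ≤ H / 8) :
    eLpNorm (fun ω => Real.exp (t * (∑ i ∈ F, b i • ε i) ω)) 2 μ
      ≤ ENNReal.ofReal (√(Real.exp (32 * C / H ^ 2 * ((2 * t) ^ 2 * ∑' i, b i ^ 2)))) := by
  have two_mul_le : ∀ i, |2 * t * b i| ≤ H / 4 := fun i => by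
    rw [mul_assoc, abs_mul, abs_two]
    linarith [ht i]
  rw [eLpNorm_exp_two_eq
    (h.integrable_exp_mul_sum_smul F fun i => by linarith [two_mul_le i, h.radius_pos])]
  gcongr
  exact h.mgf_sum_smul_le hb F two_mul_le

lemma hasSum_complexCGF_mul (hb : Summable fun i => b i ^ 2) {z : ℂ} (hz : ∀ i, ‖z * b i‖ ≤ H / 4) :
    HasSum (fun i => complexCGF (ε i) μ (z * b i)) (∑' i, complexCGF (ε i) μ (z * b i)) := by
  refine (Summable.of_norm_bounded (hb.mul_left (32 * C / H ^ 2 * ‖z‖ ^ 2)) fun i => ?_).hasSum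
  refine ((h.cramer i).norm_complexCGF_le h.radius_pos (h.integral_eq_zero i) (hz i)).trans_eq ?_
  rw [norm_mul, Complex.norm_real, mul_pow, Real.norm_eq_abs, sq_abs, mul_assoc]

section L2Limit

variable [Countable ι] (hb : Summable fun i => b i ^ 2) {S : Ω → ℝ} (hS : AEStronglyMeasurable S μ)
  (hlim : Tendsto (fun F : Finset ι => eLpNorm (∑ i ∈ F, b i • ε i - S) 2 μ) atTop (𝓝 0))
include hb hS hlim

lemma integrable_exp_mul_of_tendsto {t : ℝ} (ht : ∀ i, |t * b i| ≤ H / 8) :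
    Integrable (fun ω => Real.exp (t * S ω)) μ :=
  integrable_exp_mul_of_eLpNorm_le hS ENNReal.ofReal_ne_top <|
    eLpNorm_exp_le_of_tendsto_eLpNorm (h.aestronglyMeasurable_sum_smul) hS hlim
      fun F => h.eLpNorm_exp_sum_smul_le hb F ht

lemma complexMGF_eq_of_tendsto {z : ℂ} (hz : ∀ i, ‖z * b i‖ ≤ H / 8) :
    complexMGF S μ z = Complex.exp (∑' i, complexCGF (ε i) μ (z * b i)) := by
  have hH := h.radius_pos
  refine tendsto_nhds_unique (tendsto_complexMGF_of_tendsto_eLpNorm h.aestronglyMeasurable_sum_smul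
    hS hlim ENNReal.ofReal_ne_top fun F => h.eLpNorm_exp_sum_smul_le hb F
      fun i => (abs_re_mul_ofReal_le z (b i)).trans (hz i)) ?_
  simp only [h.complexMGF_sum_smul _ fun i => (hz i).trans_lt (by linarith)]
  exact (Complex.continuous_exp.tendsto _).comp
    (h.hasSum_complexCGF_mul hb fun i => (hz i).trans (by linarith))

end L2Limit

end IsCramerFamily

/-! ### Normalized cumulants of a weighted sum -/

/-- The cumulants of a sum of independent variables with cumulants `c j`, divided by the variance of
the sum. The cumulants of order less than three, which are known for a centred sum, are prescribed,
so that the normalization persists when the variance is zero. -/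
def normalizedCumulant {ι : Type*} (c : ι → ℕ → ℝ) : ℕ → ℝ
  | 0 => 0
  | 1 => 0
  | 2 => 1
  | k + 3 => (∑' j, c j (k + 3)) / ∑' j, c j 2

lemma abs_pow_add_two_le {b c : ℝ} (hb : |b| ≤ c) (k : ℕ) : |b ^ (k + 2)| ≤ c ^ k * b ^ 2 := by
  rw [pow_add, abs_mul, abs_pow, abs_sq]
  gcongr

namespace IsCramerFamily

variable {Ω ι : Type*} [MeasurableSpace Ω] {μ : Measure Ω} {ε : ι → Ω → ℝ} {H C c σ : ℝ} {b : ι → ℝ}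
  (h : IsCramerFamily ε μ H C)
include h

lemma bound_pos [Nonempty ι] : 0 < C :=
  (h.cramer (Classical.arbitrary ι)).bound_pos h.radius_pos

lemma abs_cumulant_mul_le (hb : ∀ j, |b j| ≤ c) (k : ℕ) (j : ι) :
    |cumulant (fun ω => b j * ε j ω) μ (k + 2)|
      ≤ C * (2 / H) ^ (k + 2) * (k + 2).factorial * c ^ k * b j ^ 2 := by
  have cumulant_le := (h.cramer j).abs_cumulant_le h.radius_pos (k + 2)
  rw [div_le_iff₀ (by positivity)] at cumulant_le
  calc |cumulant (fun ω => b j * ε j ω) μ (k + 2)|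
      = |b j ^ (k + 2)| * |cumulant (ε j) μ (k + 2)| := by rw [cumulant_const_mul, abs_mul]
    _ ≤ c ^ k * b j ^ 2 * (C * (2 / H) ^ (k + 2) * (k + 2).factorial) :=
        mul_le_mul (abs_pow_add_two_le (hb j) k) cumulant_le (abs_nonneg _)
          ((abs_nonneg _).trans (abs_pow_add_two_le (hb j) k))
    _ = C * (2 / H) ^ (k + 2) * (k + 2).factorial * c ^ k * b j ^ 2 := by ring

lemma abs_tsum_cumulant_mul_le (hb : ∀ j, |b j| ≤ c) (hsum : Summable fun j => b j ^ 2) (k : ℕ) :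
    |∑' j, cumulant (fun ω => b j * ε j ω) μ (k + 2)|
      ≤ C * (2 / H) ^ (k + 2) * (k + 2).factorial * c ^ k * ∑' j, b j ^ 2 := by
  rw [← tsum_mul_left, ← Real.norm_eq_abs]
  exact tsum_of_norm_bounded (hsum.mul_left _).hasSum (h.abs_cumulant_mul_le hb k)

variable [IsProbabilityMeasure μ]

lemma norm_cumulant_term_mul_le {z : ℂ} (hz : ∀ j, ‖z * b j‖ ≤ H / 4) (j : ι) (k : ℕ) :
    ‖((cumulant (ε j) μ k / k.factorial : ℝ) : ℂ) * (z * b j) ^ k‖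
      ≤ b j ^ 2 * (16 * C / H ^ 2 * ‖z‖ ^ 2 * (1 / 2) ^ k) := by
  refine ((h.cramer j).norm_cumulant_term_le h.radius_pos (h.integral_eq_zero j) (hz j) k).trans_eq
    ?_
  rw [norm_mul, Complex.norm_real, Real.norm_eq_abs, mul_pow, sq_abs]
  ring

lemma tsum_complexCGF_mul_eq (hsum : Summable fun j => b j ^ 2) {z : ℂ}
    (hz : ∀ j, ‖z * b j‖ ≤ H / 4) :
    ∑' j, complexCGF (ε j) μ (z * b j)
      = cumulantSeries (fun k => ∑' j, cumulant (fun ω => b j * ε j ω) μ k) z := by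
  have hH := h.radius_pos
  have geometric_summable : Summable fun k : ℕ => 16 * C / H ^ 2 * ‖z‖ ^ 2 * (1 / 2 : ℝ) ^ k :=
    summable_geometric_two.mul_left _
  have terms_summable : Summable (Function.uncurry fun (j : ι) (k : ℕ) =>
      ((cumulant (ε j) μ k / k.factorial : ℝ) : ℂ) * (z * b j) ^ k) :=
    Summable.of_norm_bounded (summable_mul_of_summable_norm hsum.norm geometric_summable.norm)
      fun p => h.norm_cumulant_term_mul_le hz p.1 p.2
  have term_eq : ∀ j k, ((cumulant (ε j) μ k / k.factorial : ℝ) : ℂ) * (z * b j) ^ k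
      = ((cumulant (fun ω => b j * ε j ω) μ k : ℝ) : ℂ) * (z ^ k / k.factorial) := fun j k => by
    rw [cumulant_const_mul]
    push_cast
    ring
  calc ∑' j, complexCGF (ε j) μ (z * b j)
      = ∑' j, ∑' k, ((cumulant (ε j) μ k / k.factorial : ℝ) : ℂ) * (z * b j) ^ k :=
        tsum_congr fun j => ((h.cramer j).hasSum_complexCGF
          (mem_ball_zero_iff.2 (by linarith [hz j]))).tsum_eq.symm
    _ = ∑' k, ∑' j, ((cumulant (ε j) μ k / k.factorial : ℝ) : ℂ) * (z * b j) ^ k :=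
        terms_summable.tsum_comm.symm
    _ = cumulantSeries (fun k => ∑' j, cumulant (fun ω => b j * ε j ω) μ k) z := by
        refine tsum_congr fun k => ?_
        simp only [term_eq, tsum_mul_right, ← Complex.ofReal_tsum]
        push_cast
        ring

variable (hvar : ∀ i, variance (ε i) μ = σ ^ 2)
include hvar

lemma tsum_cumulant_two_mul (b : ι → ℝ) :
    ∑' j, cumulant (fun ω => b j * ε j ω) μ 2 = σ ^ 2 * ∑' j, b j ^ 2 := by
  rw [← tsum_mul_left]
  refine tsum_congr fun j => ?_
  rw [cumulant_const_mul, (h.cramer j).cumulant_two h.radius_pos (h.measurable j).aemeasurable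
    (h.integral_eq_zero j), hvar, mul_comm]

lemma tsum_cumulant_mul_eq (hV : σ ^ 2 * ∑' j, b j ^ 2 ≠ 0) (k : ℕ) :
    ∑' j, cumulant (fun ω => b j * ε j ω) μ k = (σ ^ 2 * ∑' j, b j ^ 2) *
      normalizedCumulant (fun j k => cumulant (fun ω => b j * ε j ω) μ k) k := by
  match k with
  | 0 => simp only [cumulant_zero, normalizedCumulant, tsum_zero, mul_zero]
  | 1 =>
    simp only [cumulant_const_mul, (h.cramer _).cumulant_one h.radius_pos (h.integral_eq_zero _),
      normalizedCumulant, tsum_zero, mul_zero]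
  | 2 => rw [h.tsum_cumulant_two_mul hvar, normalizedCumulant, mul_one]
  | k + 3 => rw [normalizedCumulant, h.tsum_cumulant_two_mul hvar, mul_div_cancel₀ _ hV]

lemma cumulantSeries_tsum_cumulant_mul_eq (hV : σ ^ 2 * ∑' j, b j ^ 2 ≠ 0) (z : ℂ) :
    cumulantSeries (fun k => ∑' j, cumulant (fun ω => b j * ε j ω) μ k) z
      = ((σ ^ 2 * ∑' j, b j ^ 2 : ℝ) : ℂ) *
        cumulantSeries (normalizedCumulant fun j k => cumulant (fun ω => b j * ε j ω) μ k) z := by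
  simp only [cumulantSeries, h.tsum_cumulant_mul_eq hvar hV, ← tsum_mul_left]
  refine tsum_congr fun k => ?_
  push_cast
  ring

lemma abs_normalizedCumulant_add_three_le [Nonempty ι] (hσ : σ ≠ 0) (hc : 0 < c)
    (hb : ∀ j, |b j| ≤ c) (hsum : Summable fun j => b j ^ 2) (k : ℕ) :
    |normalizedCumulant (fun j k => cumulant (fun ω => b j * ε j ω) μ k) (k + 3)| /
        (k + 3).factorial ≤ C / (σ ^ 2 * c ^ 2) * (2 * c / H) ^ (k + 3) := by
  have hC := h.bound_pos
  have hH := h.radius_pos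
  have : 0 ≤ ∑' j, b j ^ 2 := tsum_nonneg fun j => sq_nonneg _
  rw [normalizedCumulant, h.tsum_cumulant_two_mul hvar, abs_div,
    abs_of_nonneg (by positivity : 0 ≤ σ ^ 2 * ∑' j, b j ^ 2), div_div]
  refine div_le_of_le_mul₀ (by positivity) (by positivity) ?_
  refine (h.abs_tsum_cumulant_mul_le hb hsum (k + 1)).trans_eq ?_
  rw [div_pow, div_pow, mul_pow]
  field_simp
  ring

lemma abs_normalizedCumulant_le [Nonempty ι] (hσ : σ ≠ 0) (hc : 0 < c) (hb : ∀ j, |b j| ≤ c)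
    (hsum : Summable fun j => b j ^ 2) (k : ℕ) :
    |normalizedCumulant (fun j k => cumulant (fun ω => b j * ε j ω) μ k) k| / k.factorial
      ≤ (C / (σ ^ 2 * c ^ 2) + 1 / (2 * c / H) ^ 2) * (2 * c / H) ^ k := by
  have hC := h.bound_pos
  have hH := h.radius_pos
  match k with
  | 0 =>
    rw [normalizedCumulant, abs_zero, zero_div]
    positivity
  | 1 =>
    rw [normalizedCumulant, abs_zero, zero_div]
    positivity
  | 2 =>
    rw [normalizedCumulant, add_mul, one_div_mul_cancel (by positivity), abs_one]
    have : 0 ≤ C / (σ ^ 2 * c ^ 2) * (2 * c / H) ^ 2 := by positivity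
    norm_num
    linarith
  | k + 3 =>
    refine (h.abs_normalizedCumulant_add_three_le hvar hσ hc hb hsum k).trans ?_
    gcongr
    exact le_add_of_nonneg_right (by positivity)

lemma hasCGFOnBall_map [Countable ι] (hc : 0 < c) (hb : ∀ j, |b j| ≤ c)
    (hsum : Summable fun j => b j ^ 2) (hV : σ ^ 2 * ∑' j, b j ^ 2 ≠ 0) {S : Ω → ℝ}
    (hS : AEStronglyMeasurable S μ)
    (hlim : Tendsto (fun F : Finset ι => eLpNorm (∑ i ∈ F, b i • ε i - S) 2 μ) atTop (𝓝 0)) :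
    HasCGFOnBall (μ.map S) (σ ^ 2 * ∑' j, b j ^ 2)
      (cumulantSeries (normalizedCumulant fun j k => cumulant (fun ω => b j * ε j ω) μ k))
      (H / (8 * c)) := by
  intro z hz
  have hH := h.radius_pos
  have norm_mul_le : ∀ j, ‖z * b j‖ ≤ H / 8 := fun j => by
    rw [norm_mul, Complex.norm_real, Real.norm_eq_abs]
    calc ‖z‖ * |b j| ≤ H / (8 * c) * c := by
          gcongr
          exacts [(mem_ball_zero_iff.1 hz).le, hb j]
      _ = H / 8 := by field_simp
  have cexp_continuous : Continuous fun x : ℝ => Complex.exp (z * x) := by fun_prop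
  constructor
  · rw [integrable_map_measure cexp_continuous.aestronglyMeasurable hS.aemeasurable]
    exact integrable_cexp_mul_of_re_mem_integrableExpSet hS.aemeasurable
      (h.integrable_exp_mul_of_tendsto hsum hS hlim
        fun j => (abs_re_mul_ofReal_le z (b j)).trans (norm_mul_le j))
  · rw [integral_map hS.aemeasurable cexp_continuous.aestronglyMeasurable, ← complexMGF,
      h.complexMGF_eq_of_tendsto hsum hS hlim norm_mul_le,
      h.tsum_complexCGF_mul_eq hsum fun j => (norm_mul_le j).trans (by linarith),
      h.cumulantSeries_tsum_cumulant_mul_eq hvar hV]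

end IsCramerFamily

lemma one_div_le_radius {A q : ℝ} (hq : 0 < q) (hA : 1 / q ^ 2 ≤ A) :
    1 / (1536 * A * q ^ 3) ≤ 1 / (4 * q) := by
  have one_le : 1 ≤ A * q ^ 2 := (div_le_iff₀ (by positivity)).1 hA
  refine one_div_le_one_div_of_le (by positivity) ?_
  calc 4 * q ≤ 1536 * q * 1 := by linarith
    _ ≤ 1536 * q * (A * q ^ 2) := by gcongr
    _ = 1536 * A * q ^ 3 := by ring

theorem exists_isNormalizedCGF_and_hasCGFOnBall {Ω ι : Type*} [MeasurableSpace Ω] (μ : Measure Ω)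
    [IsProbabilityMeasure μ] [Nonempty ι] [Countable ι] {H C σ c : ℝ} (hH : 0 < H)
    (hC : 0 < C) (hσ : σ ≠ 0) (hc : 0 < c) :
    ∃ R > 0, ∃ A, ∀ ε : ι → Ω → ℝ, IsCramerFamily ε μ H C → (∀ i, variance (ε i) μ = σ ^ 2) →
      ∀ b : ι → ℝ, (∀ j, |b j| ≤ c) → Summable (fun j => b j ^ 2) →
      let φ := cumulantSeries
        (normalizedCumulant fun j k => cumulant (fun ω => b j * ε j ω) μ k)
      IsNormalizedCGF φ R A ∧
      ∀ S : Ω → ℝ, AEStronglyMeasurable S μ →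
        Tendsto (fun F : Finset ι => eLpNorm (∑ i ∈ F, b i • ε i - S) 2 μ) atTop (𝓝 0) →
        σ ^ 2 * ∑' j, b j ^ 2 ≠ 0 → HasCGFOnBall (μ.map S) (σ ^ 2 * ∑' j, b j ^ 2) φ R := by
  set q := 2 * c / H with hq_def
  set A := C / (σ ^ 2 * c ^ 2) + 1 / q ^ 2
  have hq : 0 < q := by positivity
  refine ⟨1 / (1536 * A * q ^ 3), by positivity, 768 * A * q ^ 3,
    fun ε h hvar b hb hsum => ⟨?_, ?_⟩⟩
  · exact isNormalizedCGF_cumulantSeries hq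
      (h.abs_normalizedCumulant_le hvar hσ hc hb hsum) rfl rfl rfl
  · intro S hS hlim hV
    refine (h.hasCGFOnBall_map hvar hc hb hsum hV hS hlim).mono ?_
    have radius_eq : H / (8 * c) = 1 / (4 * q) := by rw [hq_def]; field_simp; norm_num
    rw [radius_eq]
    exact one_div_le_radius hq (le_add_of_nonneg_left (by positivity))

/-! ### Square-summable combinations of independent variables -/

section L2Series

variable {Ω ι : Type*} [MeasurableSpace Ω] {μ : Measure Ω} {ε : ι → Ω → ℝ}
  (hL2 : ∀ i, MemLp (ε i) 2 μ)

lemma inner_toLp_eq (i j : ι) :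
    inner ℝ ((hL2 i).toLp (ε i)) ((hL2 j).toLp (ε j)) = ∫ ω, ε i ω * ε j ω ∂μ := by
  rw [L2.inner_def]
  refine integral_congr_ae ?_
  filter_upwards [(hL2 i).coeFn_toLp, (hL2 j).coeFn_toLp] with ω hi hj
  rw [hi, hj, RCLike.inner_apply, conj_trivial, mul_comm]

lemma coeFn_finset_sum_smul_toLp (c : ι → ℝ) (F : Finset ι) :
    ((∑ i ∈ F, c i • (hL2 i).toLp (ε i) : Lp ℝ 2 μ) : Ω → ℝ) =ᵐ[μ] ∑ i ∈ F, c i • ε i := by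
  have coe_terms : ∀ᵐ ω ∂μ, ∀ i ∈ F,
      (c i • (hL2 i).toLp (ε i) : Lp ℝ 2 μ) ω = (c i • ε i) ω := by
    rw [Filter.eventually_all_finset]
    intro i _
    exact (Lp.coeFn_smul (c i) _).trans ((hL2 i).coeFn_toLp.const_smul (c i))
  filter_upwards [Lp.coeFn_finsetSum F fun i => c i • (hL2 i).toLp (ε i), coe_terms] with ω hsum hω
  rw [hsum, Finset.sum_apply, Finset.sum_apply]
  exact Finset.sum_congr rfl hω

lemma tendsto_eLpNorm_of_hasSum {c : ι → ℝ} {S : Lp ℝ 2 μ}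
    (h : HasSum (fun i => c i • (hL2 i).toLp (ε i)) S) :
    Tendsto (fun F : Finset ι => eLpNorm (∑ i ∈ F, c i • ε i - (S : Ω → ℝ)) 2 μ) atTop (𝓝 0) :=
  ((Lp.tendsto_Lp_iff_tendsto_eLpNorm' _ _).1 h).congr fun F =>
    eLpNorm_congr_ae ((coeFn_finset_sum_smul_toLp hL2 c F).sub (ae_eq_refl _))

variable (hmean : ∀ i, ∫ ω, ε i ω ∂μ = 0)
include hmean

lemma integral_eq_zero_of_hasSum [IsFiniteMeasure μ] {c : ι → ℝ} {S : Lp ℝ 2 μ}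
    (h : HasSum (fun i => c i • (hL2 i).toLp (ε i)) S) : ∫ ω, (S : Ω → ℝ) ω ∂μ = 0 := by
  set one : Lp ℝ 2 μ := indicatorConstLp 2 MeasurableSet.univ (measure_ne_top μ _) 1
  have inner_one : ∀ f : Lp ℝ 2 μ, inner ℝ one f = ∫ ω, (f : Ω → ℝ) ω ∂μ := fun f => by
    rw [L2.inner_indicatorConstLp_one, setIntegral_univ]
  have inner_hasSum := h.mapL (innerSL ℝ one)
  simp only [innerSL_apply_apply, inner_smul_right] at inner_hasSum
  simp only [inner_one, fun i => integral_congr_ae (hL2 i).coeFn_toLp, hmean,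
    mul_zero] at inner_hasSum
  exact inner_hasSum.unique hasSum_zero

variable {σ : ℝ} (hindep : Pairwise fun i j => IndepFun (ε i) (ε j) μ)
  (hvar : ∀ i, variance (ε i) μ = σ ^ 2) (hσ : σ ≠ 0)
include hindep hvar hσ

lemma orthonormal_toLp : Orthonormal ℝ fun i => σ⁻¹ • (hL2 i).toLp (ε i) := by
  classical
  rw [orthonormal_iff_ite]
  intro i j
  rw [inner_smul_left, inner_smul_right, inner_toLp_eq]
  split_ifs with hij
  · subst hij
    have second_moment := hvar i
    rw [variance_of_integral_eq_zero (hL2 i).1.aemeasurable (hmean i)] at second_moment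
    simp only [← sq, second_moment, conj_trivial]
    field_simp
  · rw [(hindep hij).integral_fun_mul_eq_mul_integral (hL2 i).1 (hL2 j).1, hmean i, zero_mul,
      mul_zero, mul_zero]

lemma summable_smul_toLp {c : ι → ℝ} (hc : Summable fun i => c i ^ 2) :
    Summable fun i => c i • (hL2 i).toLp (ε i) := by
  have orthogonal := (orthonormal_toLp hL2 hmean hindep hvar hσ).orthogonalFamily
  have scaled_summable := (orthogonal.summable_iff_norm_sq_summable fun i => σ * c i).2 (by
    simpa only [Real.norm_eq_abs, sq_abs, mul_pow] using hc.mul_left (σ ^ 2))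
  refine scaled_summable.congr fun i => ?_
  rw [LinearIsometry.toSpanSingleton_apply, smul_smul, mul_right_comm, mul_inv_cancel₀ hσ, one_mul]

end L2Series

/-! ### Weighted sums of a linear field over a finite window -/

section Window

variable {G : Type*} [AddCommGroup G]

/-- The coefficient of the noise `ε_j` in the weighted sum, over the window `F`, of the linear field
with coefficients `a`. -/
def windowCoeff (F : Finset G) (w a : G → ℝ) (j : G) : ℝ := ∑ i ∈ F, w i * a (i - j)

lemma summable_windowCoeff_sq {a : G → ℝ} (ha : Summable fun i => a i ^ 2) (F : Finset G)
    (w : G → ℝ) : Summable fun j => windowCoeff F w a j ^ 2 := by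
  have majorant_summable : Summable fun j => (F.card : ℝ) * ∑ i ∈ F, (w i * a (i - j)) ^ 2 := by
    refine Summable.mul_left _ (summable_sum fun i _ => ?_)
    simp only [mul_pow]
    exact ((Equiv.subLeft i).summable_iff.2 ha).mul_left _
  exact majorant_summable.of_nonneg_of_le (fun j => sq_nonneg _) fun j => sq_sum_le_card_mul_sum_sq

variable {Ω : Type*} [MeasurableSpace Ω] {μ : Measure Ω} {ε : G → Ω → ℝ}
  (hL2 : ∀ i, MemLp (ε i) 2 μ)

lemma hasSum_shift_smul_toLp {a : G → ℝ} {j : G}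
    (h : Summable fun k => a (j - k) • (hL2 k).toLp (ε k)) :
    HasSum (fun k => a (j - k) • (hL2 k).toLp (ε k))
      (∑' i, a i • (hL2 (j - i)).toLp (ε (j - i))) := by
  rw [← (Equiv.subLeft j).tsum_eq]
  simpa only [Equiv.subLeft_apply, sub_sub_cancel] using h.hasSum

lemma hasSum_windowCoeff_smul_toLp {F : Finset G} {a : G → ℝ} {X : G → Lp ℝ 2 μ} (w : G → ℝ)
    (hX : ∀ j, HasSum (fun k => a (j - k) • (hL2 k).toLp (ε k)) (X j)) :
    HasSum (fun k => windowCoeff F w a k • (hL2 k).toLp (ε k)) (∑ j ∈ F, w j • X j) := by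
  refine (hasSum_sum fun j _ => (hX j).const_smul (w j)).congr_fun fun k => ?_
  simp only [windowCoeff, Finset.sum_smul, smul_smul]

lemma sub_integral_ae_eq_of_ae_eq_const_add [IsProbabilityMeasure μ] {T S : Ω → ℝ} {m : ℝ}
    (hS : Integrable S μ) (hS0 : ∫ ω, S ω ∂μ = 0) (hT : T =ᵐ[μ] fun ω => m + S ω) :
    (fun ω => T ω - ∫ ω', T ω' ∂μ) =ᵐ[μ] S := by
  have mean_eq : ∫ ω, T ω ∂μ = m := by
    rw [integral_congr_ae hT, integral_add (integrable_const m) hS, hS0, integral_const,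
      probReal_univ, one_smul, add_zero]
  filter_upwards [hT] with ω hω
  rw [mean_eq, hω, add_sub_cancel_left]

theorem exists_hasSum_windowCoeff_smul [IsProbabilityMeasure μ] {σ : ℝ}
    (hmean : ∀ i, ∫ ω, ε i ω ∂μ = 0) (hindep : Pairwise fun i j => IndepFun (ε i) (ε j) μ)
    (hvar : ∀ i, variance (ε i) μ = σ ^ 2) (hσ : σ ≠ 0) {a : G → ℝ}
    (ha : Summable fun i => a i ^ 2) {F : Finset G} (w : G → ℝ) {f : G → ℝ} {Y : G → Ω → ℝ}
    (hY : ∀ j ∈ F, ∀ ω,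
      Y j ω = f j + (∑' i, a i • (hL2 (j - i)).toLp (ε (j - i)) : Lp ℝ 2 μ) ω) :
    ∃ S : Lp ℝ 2 μ, HasSum (fun j => windowCoeff F w a j • (hL2 j).toLp (ε j)) S ∧
      (fun ω => ∑ j ∈ F, w j * Y j ω - ∫ ω', ∑ j ∈ F, w j * Y j ω' ∂μ) =ᵐ[μ] S := by
  set X : G → Lp ℝ 2 μ := fun j => ∑' i, a i • (hL2 (j - i)).toLp (ε (j - i))
  have S_hasSum := hasSum_windowCoeff_smul_toLp hL2 (F := F) w fun j =>
    hasSum_shift_smul_toLp hL2 (summable_smul_toLp hL2 hmean hindep hvar hσ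
      ((Equiv.subLeft j).summable_iff.2 ha))
  refine ⟨_, S_hasSum, sub_integral_ae_eq_of_ae_eq_const_add (m := ∑ j ∈ F, w j * f j)
    ((Lp.memLp _).integrable one_le_two) (integral_eq_zero_of_hasSum hL2 hmean S_hasSum) ?_⟩
  filter_upwards [coeFn_finset_sum_smul_toLp (fun j => Lp.memLp (X j)) w F] with ω hω
  simp only [Lp.toLp_coeFn] at hω
  rw [hω, Finset.sum_apply, ← Finset.sum_add_distrib]
  refine Finset.sum_congr rfl fun j hj => ?_
  rw [hY j hj ω, mul_add, Pi.smul_apply, smul_eq_mul]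

end Window

/-! ### Large deviations of square-summable weighted sums -/

lemma exists_eq_mul_one_add_of_abs_div_sub_one_le {p q e : ℝ} (hq : q ≠ 0)
    (h : |p / q - 1| ≤ e) : ∃ r, |r| ≤ e ∧ p = q * (1 + r) :=
  ⟨p / q - 1, h, by rw [add_sub_cancel, mul_div_cancel₀ p hq]⟩

section ScaledTail

variable {Ω : Type*} [MeasurableSpace Ω] {μ : Measure Ω}

lemma map_const_mul_real_Ioi {S : Ω → ℝ} (hS : AEMeasurable S μ) {H : ℝ} (hH : 0 < H) (u : ℝ) :
    (μ.map fun ω => H * S ω).real (Set.Ioi (H * u)) = μ.real {ω | S ω > u} := by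
  rw [map_measureReal_apply_of_aemeasurable (hS.const_mul H) measurableSet_Ioi]
  congr 1
  ext ω
  exact mul_lt_mul_iff_right₀ hH

lemma exists_tail_eq_of_hasCGFOnBall [IsProbabilityMeasure μ] (R A : ℝ) :
    ∃ D, ∀ φ, IsNormalizedCGF φ R A → ∀ {S : Ω → ℝ}, AEMeasurable S μ →
      ∀ {H B : ℝ}, 0 < H → 0 < B → HasCGFOnBall (μ.map fun ω => H * S ω) (H ^ 2 * B) φ R →
      ∀ x, 0 ≤ x → x / (H * √B) < R / 8 → ∃ r, |r| ≤ D * ((x + 1) / (H * √B)) ∧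
        μ.real {ω | S ω > x * √B} = (1 - stdNormalCDF x) *
          Real.exp (x ^ 3 / (H * √B) * ∑' k, cramerCoeff φ k * (x / (H * √B)) ^ k) * (1 + r) := by
  obtain ⟨D, hD⟩ := exists_cramer_expansion R A
  refine ⟨D, fun φ hφ S hS H B hH hB hcgf x hx hxR => ?_⟩
  have : IsProbabilityMeasure (μ.map fun ω => H * S ω) :=
    Measure.isProbabilityMeasure_map (hS.const_mul H)
  have : 0 < √B := Real.sqrt_pos.2 hB
  have sqrtB_sq : √B * √B = B := Real.mul_self_sqrt hB.le
  have sqrt_variance : √(H ^ 2 * B) = H * √B := by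
    rw [Real.sqrt_mul (sq_nonneg H), Real.sqrt_sq hH.le]
  have argument_mul_sqrt : x / (H * √B) * (H * √B) = x := by field_simp
  have threshold_eq : x / (H * √B) * (H ^ 2 * B) = H * (x * √B) := by
    nth_rw 2 [← sqrtB_sq]
    field_simp
  have exponent_eq (s : ℝ) : H ^ 2 * B * ((x / (H * √B)) ^ 3 * s) = x ^ 3 / (H * √B) * s := by
    nth_rw 1 [← sqrtB_sq]
    field_simp
  have expansion := hD φ hφ _ _ (by positivity) hcgf _ (by positivity) hxR
  rw [sqrt_variance, argument_mul_sqrt, threshold_eq, exponent_eq, ← add_div,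
    map_const_mul_real_Ioi hS hH] at expansion
  exact exists_eq_mul_one_add_of_abs_div_sub_one_le
    (mul_pos (one_sub_stdNormalCDF_pos x) (Real.exp_pos _)).ne' expansion

end ScaledTail

section WeightedSums

variable {ι : Type*}

/-- The coefficients `β_k` of the Cramér series at scale `H` of a sum of independent variables with
cumulants `c j k`. They are read off the variables multiplied by `H`, whose cumulants are
`H ^ k * c j k`. -/
def cramerSeriesCoeff (H : ℝ) (c : ι → ℕ → ℝ) : ℕ → ℝ :=
  cramerCoeff (cumulantSeries (normalizedCumulant fun j k => H ^ k * c j k))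

variable {Ω : Type*} [MeasurableSpace Ω]

lemma cramerSeriesCoeff_cumulant (μ : Measure Ω) (ε : ι → Ω → ℝ) (b : ι → ℝ) (H : ℝ) :
    cramerSeriesCoeff H (fun j k => cumulant (fun ω => b j * ε j ω) μ k) =
      cramerCoeff (cumulantSeries (normalizedCumulant fun j k =>
        cumulant (fun ω => H * b j * ε j ω) μ k)) := by
  simp only [cramerSeriesCoeff, mul_assoc, cumulant_const_mul]

theorem exists_cramerSeries_and_tail_eq (μ : Measure Ω) [IsProbabilityMeasure μ] [Nonempty ι]
    [Countable ι] {H₀ C₀ σ c : ℝ} (hH₀ : 0 < H₀) (hC₀ : 0 < C₀) (hσ : σ ≠ 0) (hc : 0 < c) :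
    ∃ ρ > 0, ∃ D₁ D₂ : ℝ, ∀ ε : ι → Ω → ℝ, IsCramerFamily ε μ H₀ C₀ →
      (∀ i, variance (ε i) μ = σ ^ 2) → ∀ b : ι → ℝ, (Summable fun j => b j ^ 2) →
      ∀ H > 0, (∀ j, H * |b j| ≤ c) →
      let β := cramerSeriesCoeff H fun j k => cumulant (fun ω => b j * ε j ω) μ k
      let B := σ ^ 2 * ∑' j, b j ^ 2
      (∀ t : ℂ, ‖t‖ < ρ →
        Summable (fun k => (β k : ℂ) * t ^ k) ∧ ‖∑' k, (β k : ℂ) * t ^ k‖ ≤ D₁) ∧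
      ∀ (hL2 : ∀ i, MemLp (ε i) 2 μ) (S : Lp ℝ 2 μ),
        HasSum (fun j => b j • (hL2 j).toLp (ε j)) S → 0 < B →
        ∀ x, 0 ≤ x → x / (H * √B) < ρ → ∃ r, |r| ≤ D₂ * ((x + 1) / (H * √B)) ∧
          μ.real {ω | S ω > x * √B} = (1 - stdNormalCDF x) *
            Real.exp (x ^ 3 / (H * √B) * ∑' k, β k * (x / (H * √B)) ^ k) * (1 + r) := by
  obtain ⟨R, hR, A, hφ⟩ := exists_isNormalizedCGF_and_hasCGFOnBall (ι := ι) μ hH₀ hC₀ hσ hc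
  obtain ⟨D, hD⟩ := exists_tail_eq_of_hasCGFOnBall (μ := μ) R A
  refine ⟨R / 16, by positivity, 2048 / R, D, fun ε hε hvar b hb H hH hHb => ?_⟩
  intro β B
  obtain ⟨hnorm, hcgf⟩ := hφ ε hε hvar (fun j => H * b j)
    (fun j => by rw [abs_mul, abs_of_pos hH]; exact hHb j)
    (by simpa only [mul_pow] using hb.mul_left (H ^ 2))
  have variance_eq : σ ^ 2 * ∑' j, (H * b j) ^ 2 = H ^ 2 * B := by
    simp only [mul_pow, tsum_mul_left, B, mul_left_comm]
  rw [variance_eq] at hcgf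
  rw [show β = _ from cramerSeriesCoeff_cumulant μ ε b H]
  refine ⟨fun t ht => ⟨hnorm.summable_cramerCoeff_mul_pow ht.le,
    hnorm.norm_tsum_cramerCoeff_mul_pow_le ht.le⟩, fun hL2 S hS hB x hx hxR => ?_⟩
  have scaled_hasSum : HasSum (fun j => (H * b j) • (hL2 j).toLp (ε j)) (H • S) := by
    simpa only [smul_smul] using hS.const_smul H
  have law_eq : μ.map (H • S : Lp ℝ 2 μ) = μ.map fun ω => H * S ω :=
    Measure.map_congr (Lp.coeFn_smul H S)
  refine hD _ hnorm (Lp.memLp S).1.aemeasurable hH hB ?_ x hx (by linarith)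
  rw [← law_eq]
  exact hcgf _ (Lp.memLp _).1 (tendsto_eLpNorm_of_hasSum hL2 scaled_hasSum) (by positivity)

end WeightedSums

/-! ### The expansion for triangular arrays of linear fields -/

/-- The variance of the weighted sum, over the window `F`, of the linear field with coefficients `a`
and noise of variance `σ ^ 2`. -/
def windowVariance {G : Type*} [AddCommGroup G] (F : Finset G) (w a : G → ℝ) (σ : ℝ) : ℝ :=
  σ ^ 2 * ∑' j, windowCoeff F w a j ^ 2

section Estimator

variable {d m : ℕ} {K : EuclideanSpace ℝ (Fin m) → ℝ} {h : ℕ → ℝ}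
  {pt : ℕ → (Fin d → ℤ) → EuclideanSpace ℝ (Fin m)} {a : (Fin d → ℤ) → ℝ}

lemma abs_coeff_le_maxM (ha : Summable fun i => a i ^ 2) (n : ℕ) (j : Fin d → ℤ)
    (z : EuclideanSpace ℝ (Fin m)) : |coeff K h pt a n j z| ≤ maxM K h pt a n z := by
  have sq_summable : Summable fun j => coeff K h pt a n j z ^ 2 := summable_windowCoeff_sq ha _ _
  refine le_ciSup (f := fun j => |coeff K h pt a n j z|)
    ⟨√(∑' j, coeff K h pt a n j z ^ 2), ?_⟩ j
  rintro _ ⟨i, rfl⟩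
  exact Real.abs_le_sqrt (sq_summable.le_tsum i fun j _ => sq_nonneg _)

lemma exists_mul_abs_coeff_le (ha : Summable fun i => a i ^ 2) {z : EuclideanSpace ℝ (Fin m)}
    {H : ℕ → ℝ} (hH : ∀ n, 0 < H n) (hHM : IsPropTo H fun n => (maxM K h pt a n z)⁻¹) :
    ∃ c, ∀ n j, H n * |coeff K h pt a n j z| ≤ c := by
  obtain ⟨_, _, ratio_tendsto⟩ := hHM
  obtain ⟨c, hc⟩ := ratio_tendsto.bddAbove_range
  refine ⟨c, fun n j => ?_⟩
  calc H n * |coeff K h pt a n j z| ≤ H n * maxM K h pt a n z :=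
        mul_le_mul_of_nonneg_left (abs_coeff_le_maxM ha n j z) (hH n).le
    _ = H n / (maxM K h pt a n z)⁻¹ := (div_inv_eq_mul _ _).symm
    _ ≤ c := hc ⟨n, rfl⟩

end Estimator

end KernelRegression

end

open KernelRegression in
theorem mainTheorem7_general {G Ω : Type*} [AddCommGroup G] [Countable G] [MeasurableSpace Ω]
    {μ : Measure Ω} [IsProbabilityMeasure μ] {ε : ℕ → G → Ω → ℝ} {σ H₀ C₀ : ℝ}
    (hε : ∀ n, IsCramerFamily (ε n) μ H₀ C₀) (hL2 : ∀ n i, MemLp (ε n i) 2 μ)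
    (hvar : ∀ n i, variance (ε n i) μ = σ ^ 2) {a : G → ℝ} (ha : Summable fun i => a i ^ 2)
    {F : ℕ → Finset G} {w f : ℕ → G → ℝ} {Y : ℕ → G → Ω → ℝ}
    (hY : ∀ n, ∀ j ∈ F n, ∀ ω,
      Y n j ω = f n j + (∑' i, a i • (hL2 n (j - i)).toLp (ε n (j - i)) : Lp ℝ 2 μ) ω)
    {H : ℕ → ℝ} (hH : ∀ n, 0 < H n) (hHb : ∃ c, ∀ n j, H n * |windowCoeff (F n) (w n) a j| ≤ c)
    (hBH : Tendsto (fun n => windowVariance (F n) (w n) a σ * H n ^ 2) atTop atTop)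
    {β : ℕ → ℕ → ℝ} (hβ : ∀ n, β n = cramerSeriesCoeff (H n) fun j k =>
      cumulant (fun ω => windowCoeff (F n) (w n) a j * ε n j ω) μ k) :
    (∃ ρ > 0, ∃ D : ℝ, ∀ n, ∀ t : ℂ, ‖t‖ < ρ →
      Summable (fun k => (β n k : ℂ) * t ^ k) ∧ ‖∑' k, (β n k : ℂ) * t ^ k‖ ≤ D) ∧
    ∃ D : ℝ, ∀ x : ℕ → ℝ, (∀ n, 0 ≤ x n) →
      x =o[atTop] (fun n => H n * √(windowVariance (F n) (w n) a σ)) →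
      ∃ r : ℕ → ℝ, ∀ᶠ n in atTop,
        |r n| ≤ D * ((x n + 1) / (H n * √(windowVariance (F n) (w n) a σ))) ∧
        μ.real {ω | ∑ j ∈ F n, w n j * Y n j ω - ∫ ω', ∑ j ∈ F n, w n j * Y n j ω' ∂μ
            > x n * √(windowVariance (F n) (w n) a σ)} =
          (1 - stdNormalCDF (x n)) *
          Real.exp (x n ^ 3 / (H n * √(windowVariance (F n) (w n) a σ)) *
            ∑' k, β n k * (x n / (H n * √(windowVariance (F n) (w n) a σ))) ^ k) *
          (1 + r n) := by
  have hσ : σ ≠ 0 := by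
    rintro rfl
    simp [windowVariance, tendsto_const_nhds.not_tendsto (disjoint_nhds_atTop (0 : ℝ))] at hBH
  obtain ⟨c, hHb⟩ := hHb
  obtain ⟨ρ, hρ, D₁, D₂, expansion⟩ := exists_cramerSeries_and_tail_eq (ι := G) μ
    (hε 0).radius_pos (hε 0).bound_pos hσ (lt_max_of_lt_right zero_lt_one : 0 < max c 1)
  replace expansion n := expansion (ε n) (hε n) (hvar n) _ (summable_windowCoeff_sq ha (F n) (w n))
    (H n) (hH n) fun j => le_max_of_le_left (hHb n j)
  simp only [← hβ] at expansion
  choose S S_hasSum centered_eq using fun n => exists_hasSum_windowCoeff_smul (hL2 n)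
    (hε n).integral_eq_zero (fun i j hij => (hε n).indep.indepFun hij) (hvar n) hσ ha (w n) (hY n)
  refine ⟨⟨ρ, hρ, D₁, fun n => (expansion n).1⟩, D₂, fun x hx hxo => ?_⟩
  have ratio_lt := hxo.tendsto_div_nhds_zero.eventually_lt_const hρ
  obtain ⟨r, tail_eq⟩ := (((hBH.eventually_gt_atTop 0).and ratio_lt).mono fun n hn =>
    (expansion n).2 (hL2 n) (S n) (S_hasSum n) (pos_of_mul_pos_left hn.1 (sq_nonneg _))
      (x n) (hx n) hn.2).choice
  exact ⟨r, tail_eq.mono fun n hn =>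
    ⟨hn.1, hn.2 ▸ measureReal_congr ((centered_eq n).preimage (Set.Ioi _))⟩⟩

open KernelRegression in
theorem mainTheorem7 (d : ℕ) :
    -- `β_{kn} = Λ H_n (cumulants of b_{n,j}(z) ε_{n,j}, j ∈ ℤ^d) k`, one `Λ` for all models
    ∃ Λ : ℝ → ((Fin d → ℤ) → ℕ → ℝ) → ℕ → ℝ,
    ∀ (m : ℕ) {Ω : Type*} [MeasurableSpace Ω] (μ : Measure Ω) [IsProbabilityMeasure μ]
      -- innovations
      (ε : ℕ → (Fin d → ℤ) → Ω → ℝ) (σ H₀ C₀ : ℝ)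
      (_hmeas : ∀ n i, Measurable (ε n i))
      (hL2 : ∀ n i, MemLp (ε n i) 2 μ)
      (_hindep : ∀ n, iIndepFun (ε n) μ)
      (_hident : ∀ n i j, IdentDistrib (ε n i) (ε n j) μ μ)
      (_hmean : ∀ n i, ∫ ω, ε n i ω ∂μ = 0)
      (_hvar : ∀ n i, variance (ε n i) μ = σ ^ 2)
      (_hH₀ : 0 < H₀) (_hC₀ : 0 < C₀)
      (_hcramer : ∀ n i, CramerCondition (ε n i) μ H₀ C₀)
      -- coefficients of the linear random field
      (a : (Fin d → ℤ) → ℝ) (_ha : Summable (fun i => a i ^ 2))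
      -- regression function, design points, kernel and bandwidths
      (g : EuclideanSpace ℝ (Fin m) → ℝ) (_hgc : Continuous g) (_hgb : ∃ D, ∀ u, |g u| ≤ D)
      (pt : ℕ → (Fin d → ℤ) → EuclideanSpace ℝ (Fin m))
      (_hpt : ∃ T : Set (EuclideanSpace ℝ (Fin m)), IsCompact T ∧ ∀ n, ∀ j ∈ box d n, pt n j ∈ T)
      (K : EuclideanSpace ℝ (Fin m) → ℝ) (_hK : ∀ u, 0 ≤ K u)
      (h : ℕ → ℝ) (_hh : ∀ n, 0 < h n) (_hh0 : Tendsto h atTop (𝓝 0))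
      -- observations
      (Y : ℕ → (Fin d → ℤ) → Ω → ℝ)
      (_hY : ∀ n, ∀ j ∈ box d n, ∀ ω, Y n j ω = g (pt n j) + linearField μ a (ε n) (hL2 n) j ω)
      -- the point of estimation and the normalizing sequence
      (z : EuclideanSpace ℝ (Fin m))
      (H : ℕ → ℝ) (_hH : ∀ n, 0 < H n)
      (_hHM : IsPropTo H (fun n => (maxM K h pt a n z)⁻¹))
      (_hBH : Tendsto (fun n => varB K h pt a σ n z * H n ^ 2) atTop atTop)
      (β : ℕ → ℕ → ℝ)
      (_hβ : ∀ n, β n =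
        Λ (H n) (fun j k => cumulant (fun ω => coeff K h pt a n j z * ε n j ω) μ k)),
      -- the power series `∑ β_{kn} t^k` are uniformly bounded near `0`
      (∃ ρ > 0, ∃ D : ℝ, ∀ n, ∀ t : ℂ, ‖t‖ < ρ →
        Summable (fun k => (β n k : ℂ) * t ^ k) ∧ ‖∑' k, (β n k : ℂ) * t ^ k‖ ≤ D) ∧
      -- the expansion, with a constant `D` that does not depend on the sequence `x`
      ∃ D : ℝ, ∀ x : ℕ → ℝ, (∀ n, 0 ≤ x n) →
        x =o[atTop] (fun n => H n * √(varB K h pt a σ n z)) →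
        ∃ r : ℕ → ℝ, ∀ᶠ n in atTop,
          |r n| ≤ D * ((x n + 1) / (H n * √(varB K h pt a σ n z))) ∧
          μ.real {ω | estimator K h pt Y n z ω - ∫ ω', estimator K h pt Y n z ω' ∂μ
              > x n * √(varB K h pt a σ n z)} =
            (1 - stdNormalCDF (x n)) *
            Real.exp (x n ^ 3 / (H n * √(varB K h pt a σ n z)) *
              ∑' k, β n k * (x n / (H n * √(varB K h pt a σ n z))) ^ k) *
            (1 + r n) := by
  refine ⟨cramerSeriesCoeff, ?_⟩
  intro m Ω _ μ _ ε σ H₀ C₀ hmeas hL2 hindep _ hmean hvar hH₀ _ hcramer a ha g _ _ pt _ K _ h _ _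
    Y hY z H hH hHM hBH β hβ
  have noise n : IsCramerFamily (ε n) μ H₀ C₀ := ⟨hmeas n, hindep n, hmean n, hH₀, hcramer n⟩
  exact mainTheorem7_general noise hL2 hvar ha hY hH (exists_mul_abs_coeff_le ha hH hHM) hBH hβ
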